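/- Graphs are finite and may have loops and parallel edges. A \emph{plane graph} is a graph together with a topological embedding in the plane, given by the cyclic order (rotation) of the edge-ends around each vertex; a loop has two ends at its vertex. A graph is \emph{4-regular} if exactly four edge-ends are attached to each vertex. A \emph{circuit} of length $k\ge 1$ is a closed walk $(e_0,e_1,\dots,e_{k-1})$ with pairwise distinct edges, where $e_i$ is traversed from $u_i$ to $u_{i+1}$ and indices are taken modulo $k$; circuits that differ only in the starting edge or in the direction of traversal are identified. A \emph{circuit partition} of $G$ is a set of circuits such that every edge of $G$ lies in exactly one of them. In a 4-regular plane graph, a \emph{thread} with midpoint $\beta$ is an unordered pair of distinct edge-ends at $\beta$ that are not contiguous in the cyclic order around $\beta$; so every vertex is the midpoint of exactly two threads. A circuit is \emph{threaded} if, for each $i$ modulo $k$, the end at which it arrives along $e_{i-1}$ at $u_i$ and the end at which it leaves along $e_i$ form a thread $p_i$; a circuit partition is \emph{threaded} if all its circuits are. An \emph{under-over assignment} $\upsilon$ assigns a value in $\{-1,+1\}$ to each thread. It is \emph{consistent} if the two threads with midpoint $\beta$ get opposite values, for every vertex $\beta$, and it is \emph{alternating} for a threaded circuit partition $C$ if $\upsilon(p_i)=-\upsilon(p_{i+1})$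 for each circuit in $C$ and each $i$ modulo its length $k$. \textbf{Theorem.} Every 4-regular plane graph $G$ has a unique threaded circuit partition, and this threaded circuit partition has a consistent alternating under-over assignment. Further, this threaded circuit partition can be found in linear time: there is a program for a unit-cost random access machine which, given the rotation system of any 4-regular plane graph with $n$ vertices and $m$ edges, lists the circuits of its threaded circuit partition in $O(n+m+1)$ steps, using only numbers of size $O(n+m+1)$. -/

import Mathlib

universe u v

/-- The two ends (half-edges) of an edge `e` are `(e, false)` and `(e, true)`; a loop also has two
ends.  A half-edge `h` also stands for its edge traversed away from that end. -/
abbrev HalfEdge (E : Type v) : Type v := E × Bool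

/-- The other end of the same edge. -/
def HalfEdge.flip {E : Type v} (h : HalfEdge E) : HalfEdge E := (h.1, !h.2)

/-- A multigraph (loops and parallel edges allowed) with vertex set `V` and edge set `E`, embedded
in an oriented surface.  The embedding is given combinatorially: `rot h` is the half-edge that
follows `h` in the counterclockwise cyclic order of the half-edges around the vertex `vert h`. -/
structure EmbeddedGraph (V : Type u) (E : Type v) where
  /-- the vertex at which a half-edge is attached -/
  vert : HalfEdge E → V
  /-- the rotation system -/
  rot : Equiv.Perm (HalfEdge E)
  /-- the half-edges at one vertex form one cycle of the rotation -/
  vert_eq_iff : ∀ h h' : HalfEdge E, vert h = vert h' ↔ rot.SameCycle h h'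

namespace EmbeddedGraph

variable {V : Type u} {E : Type v}

/-- Connected components of the graph. -/
def Component (G : EmbeddedGraph V E) : Type u :=
  Quot fun u v : V => ∃ e : E, G.vert (e, false) = u ∧ G.vert (e, true) = v

/-- Facial walks: traverse an edge, then continue with the next half-edge in the rotation at the
vertex that has been reached. -/
def FacialWalk (G : EmbeddedGraph V E) : Type v :=
  Quot fun h h' : HalfEdge E => h' = G.rot h.flip

/-- Vertices without edges; each is a component with one face and no facial walk. -/
def IsolatedVertex (G : EmbeddedGraph V E) : Type u :=
  {v : V // ∀ h : HalfEdge E, G.vert h ≠ v}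

/-- A finite embedded graph is plane if Euler's formula `v - e + f = 2 c` holds, where `c` is the
number of components and the faces are counted for each component by itself.  As `v - e + f ≤ 2`
for a connected graph, this says that every component is embedded in the sphere. -/
def IsPlane (G : EmbeddedGraph V E) : Prop :=
  Nat.card V + (Nat.card G.FacialWalk + Nat.card G.IsolatedVertex) =
    Nat.card E + 2 * Nat.card G.Component

/-- Every vertex has degree four; a loop contributes two to the degree. -/
def IsFourRegular (G : EmbeddedGraph V E) : Prop :=
  ∀ v : V, Nat.card {h : HalfEdge E // G.vert h = v} = 4

/-- Two different half-edges at one vertex that are not contiguous in the cyclic order. -/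
def IsThread (G : EmbeddedGraph V E) (a b : HalfEdge E) : Prop :=
  G.vert a = G.vert b ∧ a ≠ b ∧ G.rot a ≠ b ∧ G.rot b ≠ a

/-- A thread, as an unordered pair of half-edges meeting at its midpoint. -/
def Thread (G : EmbeddedGraph V E) : Type v :=
  {p : Sym2 (HalfEdge E) // ∃ a b, G.IsThread a b ∧ p = s(a, b)}

/-- The thread formed by two half-edges. -/
def IsThread.thread {G : EmbeddedGraph V E} {a b : HalfEdge E} (h : G.IsThread a b) : G.Thread :=
  ⟨s(a, b), a, b, h, rfl⟩

/-- A circuit `(e_0, …, e_{k-1})`, `k ≥ 1`, with a starting edge and a direction: `darts` lists the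
traversed edges, each represented by the half-edge at which its traversal starts. -/
structure Circuit (G : EmbeddedGraph V E) where
  darts : List (HalfEdge E)
  ne_nil : darts ≠ []
  /-- the edges are distinct -/
  edges_nodup : (darts.map Prod.fst).Nodup
  /-- every edge, including the last one, ends where the (cyclically) next one starts -/
  closed : ∀ i : Fin darts.length, G.vert (darts.get i).flip =
    G.vert (darts[(i.val + 1) % darts.length]'(Nat.mod_lt _ i.pos))

namespace Circuit

variable {G : EmbeddedGraph V E}

/-- The `i`-th directed edge; indices are taken modulo the length of the circuit. -/
def dart (c : G.Circuit) (i : ℕ) : HalfEdge E :=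
  c.darts[i % c.darts.length]'(Nat.mod_lt _ (List.length_pos_of_ne_nil c.ne_nil))

/-- A circuit is threaded if any two cyclically consecutive edges form a thread at the vertex
where the circuit passes from the one to the other. -/
def IsThreaded (c : G.Circuit) : Prop :=
  ∀ i : ℕ, G.IsThread (c.dart i).flip (c.dart (i + 1))

/-- Two lists describe the same circuit if they differ by the choice of the starting edge and of
the direction of traversal. -/
def Same (c c' : G.Circuit) : Prop :=
  c.darts ~r c'.darts ∨ (c.darts.map HalfEdge.flip).reverse ~r c'.darts

theorem same_equivalence : Equivalence (Same (G := G)) := by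
  have ff : ∀ l : List (HalfEdge E),
      (((l.map HalfEdge.flip).reverse).map HalfEdge.flip).reverse = l := by
    intro l
    have : (HalfEdge.flip ∘ HalfEdge.flip : HalfEdge E → HalfEdge E) = id := by
      funext h; simp [HalfEdge.flip]
    simp [List.map_reverse, this]
  have cong : ∀ {l l' : List (HalfEdge E)}, l ~r l' →
      (l.map HalfEdge.flip).reverse ~r (l'.map HalfEdge.flip).reverse :=
    fun h => (h.map _).reverse
  refine ⟨fun c => Or.inl (List.IsRotated.refl _), ?_, ?_⟩
  · rintro c c' (h | h)
    · exact Or.inl h.symm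
    · refine Or.inr ?_
      have := cong h
      rw [ff] at this
      exact this.symm
  · rintro c c' c'' (h | h) (h' | h')
    · exact Or.inl (h.trans h')
    · exact Or.inr ((cong h).trans h')
    · exact Or.inr (h.trans h')
    · refine Or.inl ?_
      have := cong h
      rw [ff] at this
      exact this.trans h'

instance setoid (G : EmbeddedGraph V E) : Setoid G.Circuit := ⟨Same, same_equivalence⟩

end Circuit

/-- Circuits without a distinguished starting edge and direction. -/
def FreeCircuit (G : EmbeddedGraph V E) : Type v := Quotient (Circuit.setoid G)

/-- Forget the starting edge and the direction of a circuit. -/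
def Circuit.free {G : EmbeddedGraph V E} (c : G.Circuit) : G.FreeCircuit := Quotient.mk _ c

/-- A set of circuits such that every edge is in exactly one of them. -/
def IsCircuitPartition (G : EmbeddedGraph V E) (P : Set G.FreeCircuit) : Prop :=
  ∀ e : E, ∃! γ : G.FreeCircuit, γ ∈ P ∧ ∃ c : G.Circuit, c.free = γ ∧ e ∈ c.darts.map Prod.fst

/-- A circuit partition all of whose circuits are threaded. -/
def IsThreadedCircuitPartition (G : EmbeddedGraph V E) (P : Set G.FreeCircuit) : Prop :=
  G.IsCircuitPartition P ∧ ∀ c : G.Circuit, c.free ∈ P → c.IsThreaded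

/-- An under-over assignment gives `-1` or `+1` to every thread. -/
abbrev UnderOver (G : EmbeddedGraph V E) : Type v := G.Thread → ℤˣ

/-- Different threads with the same midpoint get opposite values. -/
def UnderOver.Consistent {G : EmbeddedGraph V E} (υ : G.UnderOver) : Prop :=
  ∀ (a b a' b' : HalfEdge E) (h : G.IsThread a b) (h' : G.IsThread a' b'),
    G.vert a = G.vert a' → h.thread ≠ h'.thread → υ h.thread = -υ h'.thread

/-- Cyclically consecutive threads of the circuit get opposite values. -/
def UnderOver.AlternatingOn {G : EmbeddedGraph V E} (υ : G.UnderOver) (c : G.Circuit)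
    (hc : c.IsThreaded) : Prop :=
  ∀ i : ℕ, υ (hc i).thread = -υ (hc (i + 1)).thread

/-- Alternating on every circuit of a threaded circuit partition. -/
def UnderOver.Alternating {G : EmbeddedGraph V E} (υ : G.UnderOver) {P : Set G.FreeCircuit}
    (hP : G.IsThreadedCircuitPartition P) : Prop :=
  ∀ (c : G.Circuit) (hc : c.free ∈ P), υ.AlternatingOn c (hP.2 c hc)

end EmbeddedGraph

/-! A random access machine with unit cost, programmed by while-programs. -/

namespace RAM

/-- Registers `reg 0, reg 1, …`, and a memory that is addressed through registers.  A program
mentions only finitely many registers. -/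
structure State where
  reg : ℕ → ℕ
  mem : ℕ → ℕ

/-- Programs. -/
inductive Program : Type
  /-- do nothing -/
  | skip
  /-- `reg d := k` -/
  | const (d k : ℕ)
  /-- `reg d := reg a` -/
  | copy (d a : ℕ)
  /-- `reg d := reg a + reg b` -/
  | add (d a b : ℕ)
  /-- `reg d := reg a - reg b`, or `0` if this is negative -/
  | sub (d a b : ℕ)
  /-- `reg d := mem (reg a)` -/
  | load (d a : ℕ)
  /-- `mem (reg a) := reg b` -/
  | store (a b : ℕ)
  /-- first `p`, then `q` -/
  | seq (p q : Program)
  /-- if `reg a < reg b` then `p` else `q` -/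
  | ifLt (a b : ℕ) (p q : Program)
  /-- while `reg a < reg b` do `p` -/
  | whileLt (a b : ℕ) (p : Program)

/-- Assign a value to a register. -/
def State.setReg (s : State) (d x : ℕ) : State := ⟨Function.update s.reg d x, s.mem⟩

/-- Write a value to a memory cell. -/
def State.setMem (s : State) (a x : ℕ) : State := ⟨s.reg, Function.update s.mem a x⟩

/-- `Exec B p s s' t`: started in state `s`, the program `p` halts in state `s'` after `t` steps,
and all numbers that it computes are at most `B` (there is no rule for an overflow).  Every
elementary instruction and every evaluation of a test costs one step. -/
inductive Exec (B : ℕ) : Program → State → State → ℕ → Prop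
  | skip (s : State) : Exec B .skip s s 1
  | const (s : State) (d k : ℕ) (h : k ≤ B) : Exec B (.const d k) s (s.setReg d k) 1
  | copy (s : State) (d a : ℕ) : Exec B (.copy d a) s (s.setReg d (s.reg a)) 1
  | add (s : State) (d a b : ℕ) (h : s.reg a + s.reg b ≤ B) :
      Exec B (.add d a b) s (s.setReg d (s.reg a + s.reg b)) 1
  | sub (s : State) (d a b : ℕ) : Exec B (.sub d a b) s (s.setReg d (s.reg a - s.reg b)) 1
  | load (s : State) (d a : ℕ) : Exec B (.load d a) s (s.setReg d (s.mem (s.reg a))) 1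
  | store (s : State) (a b : ℕ) : Exec B (.store a b) s (s.setMem (s.reg a) (s.reg b)) 1
  | seq {p q : Program} {s s' s'' : State} {t t' : ℕ} (h : Exec B p s s' t)
      (h' : Exec B q s' s'' t') : Exec B (.seq p q) s s'' (t + t')
  | ifTrue {p : Program} {s s' : State} {t a b : ℕ} (q : Program) (hab : s.reg a < s.reg b)
      (h : Exec B p s s' t) : Exec B (.ifLt a b p q) s s' (t + 1)
  | ifFalse {q : Program} {s s' : State} {t a b : ℕ} (p : Program) (hab : ¬ s.reg a < s.reg b)
      (h : Exec B q s s' t) : Exec B (.ifLt a b p q) s s' (t + 1)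
  | whileTrue {p : Program} {s s' s'' : State} {t t' a b : ℕ} (hab : s.reg a < s.reg b)
      (h : Exec B p s s' t) (h' : Exec B (.whileLt a b p) s' s'' t') :
      Exec B (.whileLt a b p) s s'' (t + t' + 1)
  | whileFalse {s : State} {a b : ℕ} (p : Program) (hab : ¬ s.reg a < s.reg b) :
      Exec B (.whileLt a b p) s s 1

/-- The initial state: the input is in the memory from address `0` on, all else is zero. -/
def initial (input : List ℕ) : State := ⟨fun _ => 0, fun a => input.getD a 0⟩

/-- The final state presents a list of numbers: it is in the memory from address `reg 0` on. -/
def Presents (s : State) (output : List ℕ) : Prop :=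
  ∀ i : Fin output.length, s.mem (s.reg 0 + i) = output.get i

end RAM

namespace EmbeddedGraph

/-- The half-edges of a graph with edges `0, …, m-1` in the order of their codes. -/
def halfEdges (m : ℕ) : List (HalfEdge (Fin m)) :=
  (List.finRange m).map (fun e => (e, false)) ++ (List.finRange m).map (fun e => (e, true))

/-- The code of a half-edge: `e` for `(e, false)`, and `m + e` for `(e, true)`. -/
def code {m : ℕ} (h : HalfEdge (Fin m)) : ℕ := if h.2 then m + h.1 else h.1

/-- An embedded graph as input: the numbers of vertices and of edges, then for each half-edge the
next half-edge in the rotation, then for each half-edge its vertex. -/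
def input {n m : ℕ} (G : EmbeddedGraph (Fin n) (Fin m)) : List ℕ :=
  n :: m :: ((halfEdges m).map (fun h => code (G.rot h)) ++
    (halfEdges m).map (fun h => (G.vert h : ℕ)))

/-- A list of circuits as output: the number of circuits, then for each circuit its length and its
edges, in order and with their directions. -/
def output {n m : ℕ} {G : EmbeddedGraph (Fin n) (Fin m)} (L : List G.Circuit) : List ℕ :=
  L.length :: L.flatMap (fun c => c.darts.length :: c.darts.map code)

/-- The program finds a threaded circuit partition of every plane 4-regular graph in linear time:
with `n` vertices and `m` edges it takes at most `C * (n + m + 1)` steps on numbers of at most this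
size, and lists each circuit of the partition exactly once. -/
def FindsThreadedCircuitPartitionInLinearTime (p : RAM.Program) : Prop :=
  ∃ C : ℕ, ∀ (n m : ℕ) (G : EmbeddedGraph (Fin n) (Fin m)), G.IsPlane → G.IsFourRegular →
    ∃ (s : RAM.State) (t : ℕ) (L : List G.Circuit),
      RAM.Exec (C * (n + m + 1)) p (RAM.initial G.input) s t ∧
      t ≤ C * (n + m + 1) ∧
      RAM.Presents s (output L) ∧
      (L.map Circuit.free).Nodup ∧
      G.IsThreadedCircuitPartition {γ | γ ∈ L.map Circuit.free}

end EmbeddedGraph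

/-! ### Half-edges and threads -/

/-! At a vertex of degree four, a thread joins opposite half-edges, so a threaded circuit is
determined by any one of its directed edges: it is an orbit of the injection `next`. Since `flip`
conjugates `next` to its inverse, a walk from `h` to `h.flip` would force an edge-end to be its own
flip or a thread to join a half-edge to itself at the middle of the walk. Hence orbits have distinct
edges (`IsFourRegular.nodup_orbit_edges`), reversed orbits are orbits, and threaded circuits with a
common edge agree (`IsFourRegular.same_of_common_edge`). The set of all threaded circuits is
therefore the only threaded partition.

For the under-over assignment it suffices to sign the half-edges so that the sign changes along
every edge and at every rotation step; a thread then takes the sign of its ends. The signs come from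
a two-colouring of the faces. Over the field with two elements, face boundaries are orthogonal to
vertex coboundaries, and Euler's formula makes the dimensions fit, so they form the whole orthogonal
complement. The all-ones vector lies there because all degrees are even
(`IsFourRegular.exists_faceBoundary_eq_one`).

The program scans the edges and, at each unmarked one, lists and marks its orbit. Each edge is
listed once, so the costs of the inner loops add up to a linear bound. -/

@[simp] theorem HalfEdge.flip_flip {E : Type*} (h : HalfEdge E) : h.flip.flip = h := by
  simp [HalfEdge.flip]

theorem HalfEdge.flip_ne {E : Type*} (h : HalfEdge E) : h.flip ≠ h := by
  intro H
  have := congrArg Prod.snd H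
  simp [HalfEdge.flip] at this

theorem HalfEdge.flip_injective {E : Type*} :
    Function.Injective (HalfEdge.flip : HalfEdge E → HalfEdge E) :=
  Function.LeftInverse.injective HalfEdge.flip_flip

theorem HalfEdge.eq_or_eq_flip {E : Type*} {h h' : HalfEdge E} (H : h.1 = h'.1) :
    h = h' ∨ h = h'.flip := by
  obtain ⟨e, b⟩ := h
  obtain ⟨e', b'⟩ := h'
  obtain rfl : e = e' := H
  cases b <;> cases b' <;> simp [HalfEdge.flip]

namespace EmbeddedGraph

section

variable {V : Type*} {E : Type*} {G : EmbeddedGraph V E}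

theorem vert_rot (G : EmbeddedGraph V E) (h : HalfEdge E) : G.vert (G.rot h) = G.vert h :=
  (G.vert_eq_iff _ _).2 (Equiv.Perm.sameCycle_apply_left.2 (Equiv.Perm.SameCycle.refl _ _))

/-- The rotation cycle of `h` consists of all half-edges at its vertex, so its length is the degree.
-/
theorem IsFourRegular.minimalPeriod_rot [Finite E] (hG : G.IsFourRegular) (h : HalfEdge E) :
    Function.minimalPeriod G.rot h = 4 := by
  have hper : h ∈ Function.periodicPts G.rot := G.rot.injective.mem_periodicPts h
  have hpos := Function.minimalPeriod_pos_of_mem_periodicPts hper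
  have hvert : ∀ i, G.vert (G.rot^[i] h) = G.vert h := by
    intro i
    induction i with
    | zero => rfl
    | succ i ih => rw [Function.iterate_succ_apply', vert_rot, ih]
  rw [← hG (G.vert h), ← Nat.card_fin (Function.minimalPeriod G.rot h)]
  refine Nat.card_eq_of_bijective
    (fun i : Fin (Function.minimalPeriod G.rot h) =>
      (⟨G.rot^[i] h, hvert i⟩ : {h' : HalfEdge E // G.vert h' = G.vert h})) ⟨?_, ?_⟩
  · intro i j hij
    exact Fin.ext ((Function.iterate_eq_iterate_iff_of_lt_minimalPeriod i.2 j.2).1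
      (congrArg Subtype.val hij))
  · rintro ⟨h', H⟩
    obtain ⟨i, hi⟩ := ((G.vert_eq_iff _ _).1 H.symm).exists_nat_pow_eq
    refine ⟨⟨i % _, Nat.mod_lt _ hpos⟩, Subtype.ext ?_⟩
    change G.rot^[i % _] h = h'
    rw [Function.iterate_mod_minimalPeriod_eq, Equiv.Perm.iterate_eq_pow, hi]

theorem IsFourRegular.rot_four [Finite E] (hG : G.IsFourRegular) (h : HalfEdge E) :
    G.rot (G.rot (G.rot (G.rot h))) = h := by
  have := Function.iterate_minimalPeriod (f := G.rot) (x := h)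
  rwa [hG.minimalPeriod_rot] at this

theorem IsFourRegular.iterate_rot_ne [Finite E] (hG : G.IsFourRegular) (h : HalfEdge E) {i : ℕ}
    (h0 : 0 < i) (h4 : i < 4) : G.rot^[i] h ≠ h := by
  intro H
  have := (Function.iterate_eq_iterate_iff_of_lt_minimalPeriod (f := G.rot) (x := h) (m := i)
    (n := 0) (by rw [hG.minimalPeriod_rot]; exact h4)
    (by rw [hG.minimalPeriod_rot]; exact h0.trans h4)).1 H
  omega

theorem IsFourRegular.eq_of_vert_eq [Finite E] (hG : G.IsFourRegular) {a b : HalfEdge E}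
    (hab : G.vert a = G.vert b) :
    b = a ∨ b = G.rot a ∨ b = G.rot (G.rot a) ∨ b = G.rot (G.rot (G.rot a)) := by
  obtain ⟨i, hi⟩ := ((G.vert_eq_iff _ _).1 hab).exists_nat_pow_eq
  rw [← Equiv.Perm.iterate_eq_pow, ← Function.iterate_mod_minimalPeriod_eq,
    hG.minimalPeriod_rot] at hi
  have : i % 4 < 4 := Nat.mod_lt _ (by norm_num)
  generalize i % 4 = j at hi this
  subst hi
  interval_cases j <;> simp

/-- In a 4-regular graph the threads join opposite half-edges. -/
theorem IsFourRegular.isThread_iff [Finite E] (hG : G.IsFourRegular) {a b : HalfEdge E} :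
    G.IsThread a b ↔ b = G.rot (G.rot a) := by
  constructor
  · rintro ⟨hv, h1, h2, h3⟩
    rcases hG.eq_of_vert_eq hv with h | h | h | h
    · exact absurd h.symm h1
    · exact absurd h.symm h2
    · exact h
    · exact absurd (by rw [h, hG.rot_four]) h3
  · rintro rfl
    refine ⟨by rw [vert_rot, vert_rot], ?_, ?_, ?_⟩
    · exact fun H => hG.iterate_rot_ne a (i := 2) (by norm_num) (by norm_num) H.symm
    · exact fun H => hG.iterate_rot_ne (G.rot a) (i := 1) (by norm_num) (by norm_num) H.symm
    · exact hG.iterate_rot_ne a (i := 3) (by norm_num) (by norm_num)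

/-! ### Following threads -/

/-- Traverse an edge, then leave the vertex that has been reached through the second half-edge in
the rotation; in a 4-regular graph this is the opposite one. -/
def next (G : EmbeddedGraph V E) (h : HalfEdge E) : HalfEdge E := G.rot (G.rot h.flip)

theorem next_injective (G : EmbeddedGraph V E) : Function.Injective G.next :=
  G.rot.injective.comp (G.rot.injective.comp HalfEdge.flip_injective)

theorem mem_periodicPts_next [Finite E] (G : EmbeddedGraph V E) (h : HalfEdge E) :
    h ∈ Function.periodicPts G.next :=
  G.next_injective.mem_periodicPts h

theorem minimalPeriod_next_pos [Finite E] (G : EmbeddedGraph V E) (h : HalfEdge E) :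
    0 < Function.minimalPeriod G.next h :=
  Function.minimalPeriod_pos_of_mem_periodicPts (G.mem_periodicPts_next h)

/-- The half-edges that are met when one follows threads from `h` on until one returns. -/
noncomputable def orbit (G : EmbeddedGraph V E) (h : HalfEdge E) : List (HalfEdge E) :=
  (List.range (Function.minimalPeriod G.next h)).map fun i => G.next^[i] h

@[simp] theorem length_orbit (h : HalfEdge E) :
    (G.orbit h).length = Function.minimalPeriod G.next h := by simp [orbit]

@[simp] theorem getElem_orbit (h : HalfEdge E) (i : ℕ) (hi : i < (G.orbit h).length) :
    (G.orbit h)[i] = G.next^[i] h := by simp [orbit]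

theorem Circuit.free_eq_iff {c c' : G.Circuit} : c.free = c'.free ↔ c.Same c' :=
  Quotient.eq (r := Circuit.setoid G)

theorem Circuit.Same.mem_edges_iff {c c' : G.Circuit} (hs : c.Same c') {e : E} :
    e ∈ c.darts.map Prod.fst ↔ e ∈ c'.darts.map Prod.fst := by
  rcases hs with h | h
  · exact (h.map Prod.fst).mem_iff
  · rw [← (h.map Prod.fst).mem_iff, List.map_reverse, List.mem_reverse, List.map_map]
    rfl

variable [Finite E]

/-- Reversal symmetry: the rotation has order four at every half-edge, so two more rotations undo
the first two and the thread is retraced. -/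
theorem IsFourRegular.next_flip_next (hG : G.IsFourRegular) (h : HalfEdge E) :
    G.next (G.next h).flip = h.flip := by
  rw [next, HalfEdge.flip_flip, next, hG.rot_four]

theorem IsFourRegular.iterate_next_flip (hG : G.IsFourRegular) (i : ℕ) (h : HalfEdge E) :
    G.next^[i] (G.next^[i] h).flip = h.flip := by
  induction i generalizing h with
  | zero => rfl
  | succ i ih =>
    rw [Function.iterate_succ_apply' G.next i (G.next^[i + 1] h).flip,
      Function.iterate_succ_apply G.next i h, ih, hG.next_flip_next]

theorem IsFourRegular.next_ne_flip (hG : G.IsFourRegular) (h : HalfEdge E) :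
    G.next h ≠ h.flip :=
  hG.iterate_rot_ne h.flip (i := 2) (by norm_num) (by norm_num)

/-- Following threads never leads back to the same edge in the opposite direction. -/
theorem IsFourRegular.iterate_next_ne_flip (hG : G.IsFourRegular) (k : ℕ) (h : HalfEdge E) :
    G.next^[k] h ≠ h.flip := by
  intro H
  -- Cancelling `j` steps leads to the middle of the walk: for even `k` a half-edge there equals its
  -- own flip, for odd `k` the walk turns back through the end by which it arrived.
  obtain ⟨j, rfl | rfl⟩ := k.even_or_odd'
  · rw [two_mul, Function.iterate_add_apply, ← hG.iterate_next_flip j h] at H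
    exact HalfEdge.flip_ne _ (G.next_injective.iterate j H).symm
  · rw [show 2 * j + 1 = j + (j + 1) by ring, Function.iterate_add_apply,
      ← hG.iterate_next_flip j h, Function.iterate_succ_apply'] at H
    exact hG.next_ne_flip _ (G.next_injective.iterate j H)

theorem IsFourRegular.iterate_next_ne_flip_iterate (hG : G.IsFourRegular) (i j : ℕ)
    (h : HalfEdge E) : G.next^[i] h ≠ (G.next^[j] h).flip := by
  intro H
  rcases le_total j i with hij | hij
  · obtain ⟨k, rfl⟩ := Nat.exists_eq_add_of_le' hij
    rw [Function.iterate_add_apply] at H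
    exact hG.iterate_next_ne_flip _ _ H
  · obtain ⟨k, rfl⟩ := Nat.exists_eq_add_of_le' hij
    rw [Function.iterate_add_apply] at H
    exact hG.iterate_next_ne_flip k (G.next^[i] h) (HalfEdge.flip_injective (by simpa using H.symm))

theorem IsFourRegular.iterate_next_fst_eq_iff (hG : G.IsFourRegular) {i j : ℕ} {h : HalfEdge E} :
    (G.next^[i] h).1 = (G.next^[j] h).1 ↔ G.next^[i] h = G.next^[j] h :=
  ⟨fun H => (HalfEdge.eq_or_eq_flip H).resolve_right (hG.iterate_next_ne_flip_iterate i j h),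
    congrArg Prod.fst⟩

theorem IsFourRegular.minimalPeriod_next_flip (hG : G.IsFourRegular) (h : HalfEdge E) :
    Function.minimalPeriod G.next h.flip = Function.minimalPeriod G.next h := by
  have key : ∀ h : HalfEdge E,
      Function.minimalPeriod G.next h.flip ∣ Function.minimalPeriod G.next h := by
    intro h
    refine Function.IsPeriodicPt.minimalPeriod_dvd ?_
    have := hG.iterate_next_flip (Function.minimalPeriod G.next h) h
    rwa [Function.iterate_minimalPeriod] at this
  refine Nat.dvd_antisymm (key h) ?_
  simpa using key h.flip

theorem mem_orbit {h h' : HalfEdge E} : h' ∈ G.orbit h ↔ ∃ i, G.next^[i] h = h' := by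
  constructor
  · rw [orbit, List.mem_map]
    rintro ⟨i, -, hi⟩
    exact ⟨i, hi⟩
  · rintro ⟨i, rfl⟩
    rw [orbit, List.mem_map]
    exact ⟨i % _, List.mem_range.2 (Nat.mod_lt _ (G.minimalPeriod_next_pos h)),
      Function.iterate_mod_minimalPeriod_eq⟩

theorem orbit_ne_nil (G : EmbeddedGraph V E) (h : HalfEdge E) : G.orbit h ≠ [] :=
  List.ne_nil_of_mem (mem_orbit.2 ⟨0, rfl⟩)

theorem orbit_rotate (h : HalfEdge E) (i : ℕ) :
    (G.orbit h).rotate i = G.orbit (G.next^[i] h) := by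
  refine List.ext_getElem ?_ fun j hj hj' => ?_
  · rw [List.length_rotate, length_orbit, length_orbit,
      Function.minimalPeriod_apply_iterate (G.mem_periodicPts_next h)]
  · rw [List.getElem_rotate, getElem_orbit, getElem_orbit, length_orbit,
      Function.iterate_mod_minimalPeriod_eq, Function.iterate_add_apply]

/-- By reversal symmetry the reversed list follows threads again; it starts with the flip of the
last entry, which explains the exponent. -/
theorem IsFourRegular.reverse_map_flip_orbit (hG : G.IsFourRegular) (h : HalfEdge E) :
    ((G.orbit h).map HalfEdge.flip).reverse =
      G.orbit (G.next^[Function.minimalPeriod G.next h - 1] h).flip := by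
  refine List.ext_getElem ?_ fun j hj hj' => ?_
  · rw [List.length_reverse, List.length_map, length_orbit, length_orbit,
      hG.minimalPeriod_next_flip,
      Function.minimalPeriod_apply_iterate (G.mem_periodicPts_next h)]
  · simp only [List.length_reverse, List.length_map, length_orbit] at hj
    rw [List.getElem_reverse, List.getElem_map, getElem_orbit, getElem_orbit]
    simp only [List.length_map, length_orbit]
    rw [← hG.iterate_next_flip j, ← Function.iterate_add_apply, Nat.add_sub_cancel' (by omega)]

theorem IsFourRegular.nodup_orbit_edges (hG : G.IsFourRegular) (h : HalfEdge E) :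
    ((G.orbit h).map Prod.fst).Nodup := by
  rw [orbit, List.map_map]
  refine List.Nodup.map_on (fun i hi j hj hij => ?_) List.nodup_range
  exact (Function.iterate_eq_iterate_iff_of_lt_minimalPeriod (List.mem_range.1 hi)
    (List.mem_range.1 hj)).1 (hG.iterate_next_fst_eq_iff.1 hij)

/-! ### Threaded circuits -/

/-- The circuit that follows threads from `h` on. -/
noncomputable def IsFourRegular.circuit (hG : G.IsFourRegular) (h : HalfEdge E) : G.Circuit where
  darts := G.orbit h
  ne_nil := G.orbit_ne_nil h
  edges_nodup := hG.nodup_orbit_edges h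
  closed i := by
    simp only [List.get_eq_getElem, getElem_orbit]
    generalize (i : ℕ) = j
    rw [length_orbit, Function.iterate_mod_minimalPeriod_eq, Function.iterate_succ_apply', next,
      vert_rot, vert_rot]

theorem IsFourRegular.isThreaded_of_darts_eq (hG : G.IsFourRegular) {c : G.Circuit}
    {h : HalfEdge E} (hc : c.darts = G.orbit h) : c.IsThreaded := by
  have hd : ∀ i, c.dart i = G.next^[i] h := by
    intro i
    simp only [Circuit.dart, hc, getElem_orbit, length_orbit,
      Function.iterate_mod_minimalPeriod_eq]
  intro i
  rw [hG.isThread_iff, hd, hd, Function.iterate_succ_apply', next]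

theorem IsFourRegular.dart_eq (hG : G.IsFourRegular) {c : G.Circuit} (hc : c.IsThreaded) (i : ℕ) :
    c.dart i = G.next^[i] (c.dart 0) := by
  induction i with
  | zero => rfl
  | succ i ih => rw [Function.iterate_succ_apply', ← ih, next, ← hG.isThread_iff]; exact hc i

/-- A threaded circuit runs around its orbit exactly once: closing up makes its length a multiple of
the period, and distinct edges exclude a second round. -/
theorem IsFourRegular.darts_eq (hG : G.IsFourRegular) {c : G.Circuit} (hc : c.IsThreaded) :
    c.darts = G.orbit (c.dart 0) := by
  have hpos : 0 < c.darts.length := List.length_pos_of_ne_nil c.ne_nil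
  have hget : ∀ i (hi : i < c.darts.length), c.darts[i] = G.next^[i] (c.dart 0) := by
    intro i hi
    rw [← hG.dart_eq hc]
    simp only [Circuit.dart, Nat.mod_eq_of_lt hi]
  have hper : Function.minimalPeriod G.next (c.dart 0) ∣ c.darts.length := by
    refine Function.IsPeriodicPt.minimalPeriod_dvd ?_
    have := hG.dart_eq hc c.darts.length
    simp only [Circuit.dart, Nat.mod_self, Nat.zero_mod] at this
    exact this.symm
  have hlen : c.darts.length = Function.minimalPeriod G.next (c.dart 0) := by
    refine le_antisymm ?_ (Nat.le_of_dvd hpos hper)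
    by_contra! hlt
    have hnd := c.edges_nodup.of_map
    have h0 : c.darts[Function.minimalPeriod G.next (c.dart 0)] = c.darts[0] := by
      rw [hget _ hlt, hget _ hpos, Function.iterate_minimalPeriod]; rfl
    have := (hnd.getElem_inj_iff).1 h0
    have := G.minimalPeriod_next_pos (c.dart 0)
    omega
  refine List.ext_getElem (by rw [hlen, length_orbit]) fun i hi hi' => ?_
  rw [hget, getElem_orbit]

theorem IsFourRegular.isThreaded_iff (hG : G.IsFourRegular) {c : G.Circuit} :
    c.IsThreaded ↔ ∃ h, c.darts = G.orbit h :=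
  ⟨fun hc => ⟨_, hG.darts_eq hc⟩, fun ⟨_, hh⟩ => hG.isThreaded_of_darts_eq hh⟩

/-- Lets threadedness pass to free circuits: rotations and reversals of orbits are orbits. -/
theorem IsFourRegular.isThreaded_of_same (hG : G.IsFourRegular) {c c' : G.Circuit}
    (hc : c.IsThreaded) (hs : c.Same c') : c'.IsThreaded := by
  obtain ⟨h, hh⟩ := hG.isThreaded_iff.1 hc
  rcases hs with ⟨i, hi⟩ | ⟨i, hi⟩
  · rw [hh, orbit_rotate] at hi
    exact hG.isThreaded_of_darts_eq hi.symm
  · rw [hh, hG.reverse_map_flip_orbit, orbit_rotate] at hi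
    exact hG.isThreaded_of_darts_eq hi.symm

theorem orbit_isRotated_of_mem {h h' : HalfEdge E} (H : h' ∈ G.orbit h) :
    G.orbit h ~r G.orbit h' := by
  obtain ⟨i, rfl⟩ := mem_orbit.1 H
  exact ⟨i, orbit_rotate h i⟩

/-- Threaded circuits with a common edge are the same. -/
theorem IsFourRegular.same_of_common_edge (hG : G.IsFourRegular) {c c' : G.Circuit}
    (hc : c.IsThreaded) (hc' : c'.IsThreaded) {e : E} (he : e ∈ c.darts.map Prod.fst)
    (he' : e ∈ c'.darts.map Prod.fst) : c.Same c' := by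
  obtain ⟨h, hh⟩ := hG.isThreaded_iff.1 hc
  obtain ⟨h', hh'⟩ := hG.isThreaded_iff.1 hc'
  obtain ⟨d, hd, rfl⟩ := List.mem_map.1 he
  obtain ⟨d', hd', hdd⟩ := List.mem_map.1 he'
  rw [hh'] at hd'
  have r' := orbit_isRotated_of_mem hd'
  rcases HalfEdge.eq_or_eq_flip hdd with rfl | rfl
  · rw [hh] at hd
    refine Or.inl ?_
    rw [hh, hh']
    exact (orbit_isRotated_of_mem hd).trans r'.symm
  · refine Or.inr ?_
    have hd2 : HalfEdge.flip d ∈ (c.darts.map HalfEdge.flip).reverse :=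
      List.mem_reverse.2 (List.mem_map_of_mem hd)
    rw [hh, hG.reverse_map_flip_orbit] at hd2 ⊢
    rw [hh']
    exact (orbit_isRotated_of_mem hd2).trans r'.symm

/-- The set of all threaded circuits. -/
def threadedCircuits (G : EmbeddedGraph V E) : Set G.FreeCircuit :=
  {γ | ∃ c : G.Circuit, c.IsThreaded ∧ c.free = γ}

theorem IsFourRegular.isThreadedCircuitPartition (hG : G.IsFourRegular) :
    G.IsThreadedCircuitPartition G.threadedCircuits := by
  constructor
  · intro e
    have hc : (hG.circuit (e, false)).IsThreaded := hG.isThreaded_of_darts_eq rfl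
    have he : e ∈ (hG.circuit (e, false)).darts.map Prod.fst :=
      List.mem_map.2 ⟨(e, false), mem_orbit.2 ⟨0, rfl⟩, rfl⟩
    refine ⟨(hG.circuit (e, false)).free, ⟨⟨_, hc, rfl⟩, _, rfl, he⟩, ?_⟩
    rintro γ ⟨⟨c, hct, rfl⟩, c', hcc', he'⟩
    rw [← hcc', Circuit.free_eq_iff]
    exact hG.same_of_common_edge
      (hG.isThreaded_of_same hct (Circuit.free_eq_iff.1 hcc'.symm)) hc he' he
  · rintro c ⟨c', hc', h⟩
    exact hG.isThreaded_of_same hc' (Circuit.free_eq_iff.1 h)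

/-- A set of threaded circuits that covers all edges contains every threaded circuit. -/
theorem IsFourRegular.eq_threadedCircuits (hG : G.IsFourRegular) {P : Set G.FreeCircuit}
    (hP : ∀ c : G.Circuit, c.free ∈ P → c.IsThreaded)
    (hcov : ∀ e : E, ∃ c : G.Circuit, c.free ∈ P ∧ e ∈ c.darts.map Prod.fst) :
    P = G.threadedCircuits := by
  ext γ
  constructor
  · intro hγ
    obtain ⟨c, rfl⟩ := Quotient.exists_rep γ
    exact ⟨c, hP c hγ, rfl⟩
  · rintro ⟨c, hc, rfl⟩
    obtain ⟨d, hd⟩ := List.exists_mem_of_ne_nil _ c.ne_nil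
    obtain ⟨c', hc', he⟩ := hcov d.1
    rwa [Circuit.free_eq_iff.2
      (hG.same_of_common_edge hc (hP c' hc') (List.mem_map_of_mem hd) he)]

theorem IsFourRegular.existsUnique_threadedCircuitPartition (hG : G.IsFourRegular) :
    ∃! P : Set G.FreeCircuit, G.IsThreadedCircuitPartition P := by
  refine ⟨_, hG.isThreadedCircuitPartition, fun P hP => hG.eq_threadedCircuits hP.2 fun e => ?_⟩
  obtain ⟨γ, ⟨hγ, c, rfl, he⟩, -⟩ := hP.1 e
  exact ⟨c, hγ, he⟩

end

end EmbeddedGraph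

namespace EmbeddedGraph

/-! ### Two-colouring the faces of a plane graph -/

section

variable {V : Type*} {E : Type*} {G : EmbeddedGraph V E}

instance [Finite V] : Finite G.Component := Quot.finite _

instance [Finite E] : Finite G.FacialWalk := Quot.finite _

/-- The facial walk along a half-edge. -/
def face (G : EmbeddedGraph V E) (h : HalfEdge E) : G.FacialWalk := Quot.mk _ h

/-- The component of a vertex. -/
def component (G : EmbeddedGraph V E) (v : V) : G.Component := Quot.mk _ v

theorem face_rot_flip (G : EmbeddedGraph V E) (h : HalfEdge E) :
    G.face (G.rot h.flip) = G.face h :=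
  (Quot.sound (r := fun h h' : HalfEdge E => h' = G.rot h.flip) rfl).symm

/-- The coboundary of a function on the vertices, modulo two. -/
def coboundary (G : EmbeddedGraph V E) : (V → ZMod 2) →ₗ[ZMod 2] (E → ZMod 2) where
  toFun g e := g (G.vert (e, false)) + g (G.vert (e, true))
  map_add' g g' := by ext e; simp only [Pi.add_apply]; ring
  map_smul' a g := by ext e; simp only [Pi.smul_apply, smul_eq_mul, RingHom.id_apply]; ring

/-- The boundary of a function on the faces, modulo two. -/
def faceBoundary (G : EmbeddedGraph V E) : (G.FacialWalk → ZMod 2) →ₗ[ZMod 2] (E → ZMod 2) where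
  toFun f e := f (G.face (e, false)) + f (G.face (e, true))
  map_add' g g' := by ext e; simp only [Pi.add_apply]; ring
  map_smul' a g := by ext e; simp only [Pi.smul_apply, smul_eq_mul, RingHom.id_apply]; ring

theorem coboundary_fst (g : V → ZMod 2) (h : HalfEdge E) :
    G.coboundary g h.1 = g (G.vert h) + g (G.vert h.flip) := by
  obtain ⟨e, _ | _⟩ := h
  · rfl
  · exact add_comm _ _

theorem faceBoundary_fst (f : G.FacialWalk → ZMod 2) (h : HalfEdge E) :
    G.faceBoundary f h.1 = f (G.face h) + f (G.face h.flip) := by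
  obtain ⟨e, _ | _⟩ := h
  · rfl
  · exact add_comm _ _

theorem sum_halfEdge [Fintype E] {M : Type*} [AddCommMonoid M] (x : HalfEdge E → M) :
    ∑ h, x h = ∑ e, (x (e, false) + x (e, true)) := by
  rw [Fintype.sum_prod_type]
  exact Finset.sum_congr rfl fun e _ => by rw [Fintype.sum_bool, add_comm]

/-- Summed over half-edges, the contributions of the two ends of an edge agree: `h ↦ G.rot h.flip`
keeps the face of `h` and goes to the vertex of `h.flip`. Modulo two they cancel. -/
theorem faceBoundary_dotProduct_coboundary [Fintype E] (f : G.FacialWalk → ZMod 2)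
    (g : V → ZMod 2) : ∑ e, G.faceBoundary f e * G.coboundary g e = 0 := by
  have h1 : ∑ e, G.faceBoundary f e * G.coboundary g e =
      ∑ h : HalfEdge E, f (G.face h) * G.coboundary g h.1 := by
    rw [sum_halfEdge]
    exact Finset.sum_congr rfl fun e _ => add_mul _ _ _
  have h2 : ∑ h : HalfEdge E, f (G.face h) * g (G.vert h.flip) =
      ∑ h : HalfEdge E, f (G.face h) * g (G.vert h) := by
    refine Fintype.sum_bijective (fun h : HalfEdge E => G.rot h.flip)
      (G.rot.bijective.comp (Function.Involutive.bijective HalfEdge.flip_flip)) _ _ fun h => ?_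
    rw [face_rot_flip, vert_rot]
  simp_rw [h1, coboundary_fst, mul_add, Finset.sum_add_distrib, h2, CharTwo.add_self_eq_zero]

/-- Each vertex value is counted as often as its degree, which is zero modulo two. -/
theorem IsFourRegular.sum_coboundary [Finite V] [Fintype E] (hG : G.IsFourRegular)
    (g : V → ZMod 2) : ∑ e, G.coboundary g e = 0 := by
  classical
  have := Fintype.ofFinite V
  have h1 : ∑ e, G.coboundary g e = ∑ h : HalfEdge E, g (G.vert h) :=
    (sum_halfEdge fun h => g (G.vert h)).symm
  rw [h1, ← Finset.sum_fiberwise (s := Finset.univ) (g := G.vert)]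
  refine Finset.sum_eq_zero fun v _ => ?_
  have h2 : ∑ h ∈ Finset.univ.filter (fun h => G.vert h = v), g (G.vert h) =
      ∑ h ∈ Finset.univ.filter (fun h => G.vert h = v), g v :=
    Finset.sum_congr rfl fun h hh => by rw [(Finset.mem_filter.1 hh).2]
  rw [h2, Finset.sum_const, ← Fintype.card_subtype, ← Nat.card_eq_fintype_card, hG v, nsmul_eq_mul]
  have : ((4 : ℕ) : ZMod 2) = 0 := by decide
  rw [this, zero_mul]

/-- A function in the kernel is constant along edges, so it is pulled back from the components. -/
theorem finrank_ker_coboundary_le [Finite V] (G : EmbeddedGraph V E) :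
    Module.finrank (ZMod 2) (LinearMap.ker G.coboundary) ≤ Nat.card G.Component := by
  classical
  have := Fintype.ofFinite V
  have := Fintype.ofFinite G.Component
  have hle : LinearMap.ker G.coboundary ≤
      LinearMap.range (LinearMap.funLeft (ZMod 2) (ZMod 2) G.component) := by
    intro g hg
    have hg' : ∀ e, g (G.vert (e, false)) = g (G.vert (e, true)) := fun e =>
      CharTwo.add_eq_zero.1 (congrFun hg e)
    refine ⟨Quot.lift g ?_, rfl⟩
    rintro u v ⟨e, rfl, rfl⟩
    exact hg' e
  refine (Submodule.finrank_mono hle).trans ((LinearMap.finrank_range_le _).trans ?_)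
  rw [Module.finrank_fintype_fun_eq_card, Nat.card_eq_fintype_card]

theorem IsFourRegular.exists_vert_eq (hG : G.IsFourRegular) (v : V) : ∃ h, G.vert h = v := by
  by_contra! H
  have : IsEmpty {h : HalfEdge E // G.vert h = v} := ⟨fun h => H h.1 h.2⟩
  have h4 := hG v
  rw [Nat.card_of_isEmpty] at h4
  omega

/-- A function in the kernel does not change across an edge. As `G.rot h` lies on the facial walk of
`h.flip`, it does not change around a vertex either, so it descends to the components. -/
theorem IsFourRegular.finrank_ker_faceBoundary_le [Finite V] [Finite E] (hG : G.IsFourRegular) :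
    Module.finrank (ZMod 2) (LinearMap.ker G.faceBoundary) ≤ Nat.card G.Component := by
  classical
  have := Fintype.ofFinite V
  have := Fintype.ofFinite E
  have := Fintype.ofFinite G.Component
  have := Fintype.ofFinite G.FacialWalk
  have hcomp : ∀ h h' : HalfEdge E, h' = G.rot h.flip →
      G.component (G.vert h) = G.component (G.vert h') := by
    rintro ⟨e, _ | _⟩ _ rfl
    · rw [vert_rot]; exact Quot.sound ⟨e, rfl, rfl⟩
    · rw [vert_rot]; exact (Quot.sound ⟨e, rfl, rfl⟩).symm
  let π : G.FacialWalk → G.Component := Quot.lift (fun h => G.component (G.vert h)) hcomp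
  have hle : LinearMap.ker G.faceBoundary ≤
      LinearMap.range (LinearMap.funLeft (ZMod 2) (ZMod 2) π) := by
    intro f hf
    have hflip : ∀ h : HalfEdge E, f (G.face h.flip) = f (G.face h) := fun h =>
      (CharTwo.add_eq_zero.1 ((faceBoundary_fst f h).symm.trans (congrFun hf h.1))).symm
    have hrot : ∀ h : HalfEdge E, f (G.face (G.rot h)) = f (G.face h) := fun h => by
      rw [← hflip h, ← face_rot_flip G h.flip, HalfEdge.flip_flip]
    have hvert : ∀ h h' : HalfEdge E, G.vert h = G.vert h' → f (G.face h) = f (G.face h') := by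
      intro h h' H
      rcases hG.eq_of_vert_eq H with rfl | rfl | rfl | rfl <;> simp only [hrot]
    choose d hd using hG.exists_vert_eq
    refine ⟨Quot.lift (fun v => f (G.face (d v))) ?_, ?_⟩
    · rintro u v ⟨e, rfl, rfl⟩
      rw [hvert _ _ (hd (G.vert (e, false))), hvert _ _ (hd (G.vert (e, true)))]
      exact (hflip (e, false)).symm
    · ext φ
      induction φ using Quot.ind with
      | mk h => exact hvert _ _ (hd (G.vert h))
  refine (Submodule.finrank_mono hle).trans ((LinearMap.finrank_range_le _).trans ?_)
  rw [Module.finrank_fintype_fun_eq_card, Nat.card_eq_fintype_card]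

/-- In a 4-regular plane graph the facial walks generate all cycles modulo two, in particular the
set of all edges: the faces can be coloured with two colours. -/
theorem IsFourRegular.exists_faceBoundary_eq_one [Finite V] [Finite E] (hG : G.IsFourRegular)
    (hP : G.IsPlane) : ∃ f : G.FacialWalk → ZMod 2, G.faceBoundary f = 1 := by
  classical
  have := Fintype.ofFinite V
  have := Fintype.ofFinite E
  have := Fintype.ofFinite G.FacialWalk
  let B : LinearMap.BilinForm (ZMod 2) (E → ZMod 2) := Matrix.toBilin' 1
  have hB : ∀ x y, B x y = ∑ e, x e * y e := fun x y => by
    simp [B, Matrix.toBilin'_apply', dotProduct]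
  have hBn : B.Nondegenerate :=
    LinearMap.BilinForm.nondegenerate_toBilin'_of_det_ne_zero' _ (by simp)
  have hle : LinearMap.range G.faceBoundary ≤ B.orthogonal (LinearMap.range G.coboundary) := by
    rintro _ ⟨f, rfl⟩
    rw [LinearMap.BilinForm.mem_orthogonal_iff]
    rintro _ ⟨g, rfl⟩
    rw [hB]
    simp_rw [mul_comm (G.coboundary g _)]
    exact faceBoundary_dotProduct_coboundary f g
  -- With `v`, `e`, `f`, `c` the numbers in Euler's formula, the complement has dimension at most `e
  -- - v + c` and the face boundaries have rank at least `f - c`; Euler's formula says that these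
  -- bounds are equal.
  have hdim : Module.finrank (ZMod 2) (B.orthogonal (LinearMap.range G.coboundary)) ≤
      Module.finrank (ZMod 2) (LinearMap.range G.faceBoundary) := by
    rw [LinearMap.BilinForm.finrank_orthogonal hBn]
    have h1 := LinearMap.finrank_range_add_finrank_ker G.coboundary
    have h2 := LinearMap.finrank_range_add_finrank_ker G.faceBoundary
    have h3 := G.finrank_ker_coboundary_le
    have h4 := hG.finrank_ker_faceBoundary_le
    have h5 : Nat.card G.IsolatedVertex = 0 := by
      have : IsEmpty G.IsolatedVertex := ⟨fun v => by
        obtain ⟨h, hh⟩ := hG.exists_vert_eq v.1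
        exact v.2 h hh⟩
      exact Nat.card_of_isEmpty
    have h6 : Nat.card V + (Nat.card G.FacialWalk + Nat.card G.IsolatedVertex) =
      Nat.card E + 2 * Nat.card G.Component := hP
    rw [Module.finrank_fintype_fun_eq_card, ← Nat.card_eq_fintype_card] at h1 h2 ⊢
    omega
  have heq := Submodule.eq_of_le_of_finrank_le hle hdim
  have hone : (1 : E → ZMod 2) ∈ B.orthogonal (LinearMap.range G.coboundary) := by
    rw [LinearMap.BilinForm.mem_orthogonal_iff]
    rintro _ ⟨g, rfl⟩
    rw [hB]
    simpa using hG.sum_coboundary g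
  rwa [← heq] at hone

/-! ### The under-over assignment -/

/-- Half-edges can be signed such that the sign changes along edges and in the rotation. -/
theorem IsFourRegular.exists_sign [Finite V] [Finite E] (hG : G.IsFourRegular) (hP : G.IsPlane) :
    ∃ x : HalfEdge E → ℤˣ, (∀ h, x h.flip = -x h) ∧ ∀ h, x (G.rot h) = -x h := by
  obtain ⟨f, hf⟩ := hG.exists_faceBoundary_eq_one hP
  have key : ∀ a b : ZMod 2, a + b = 1 →
      (if b = 0 then (1 : ℤˣ) else -1) = -(if a = 0 then (1 : ℤˣ) else -1) := by decide
  let x : HalfEdge E → ℤˣ := fun h => if f (G.face h) = 0 then 1 else -1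
  have hflip : ∀ h, x h.flip = -x h := fun h =>
    key _ _ ((faceBoundary_fst f h).symm.trans (congrFun hf h.1))
  refine ⟨x, hflip, fun h => ?_⟩
  -- `G.rot h` and `h.flip` lie on the same facial walk.
  rw [← hflip]
  simp only [x]
  rw [← face_rot_flip G h.flip, HalfEdge.flip_flip]

theorem IsFourRegular.exists_consistent_alternating [Finite V] [Finite E] (hG : G.IsFourRegular)
    (hP : G.IsPlane) (P : Set G.FreeCircuit) (hC : G.IsThreadedCircuitPartition P) :
    ∃ υ : G.UnderOver, υ.Consistent ∧ υ.Alternating hC := by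
  obtain ⟨x, hflip, hrot⟩ := hG.exists_sign hP
  -- An arbitrary end is chosen; the two ends are two rotations apart and have the same sign, so the
  -- choice is harmless.
  let υ : G.UnderOver := fun p => x p.2.choose
  have hυ : ∀ {a b : HalfEdge E} (h : G.IsThread a b), υ h.thread = x a := by
    intro a b h
    obtain ⟨b', hb', heq⟩ := h.thread.2.choose_spec
    have heq' : s(a, b) = s(h.thread.2.choose, b') := heq
    change x h.thread.2.choose = x a
    rcases Sym2.eq_iff.1 heq' with ⟨h1, -⟩ | ⟨-, h1⟩
    · rw [← h1]
    · rw [← h1, hG.isThread_iff.1 h, hrot, hrot, neg_neg]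
  refine ⟨υ, ?_, ?_⟩
  · intro a b a' b' h h' hv hne
    rw [hυ, hυ]
    have hb := hG.isThread_iff.1 h
    have hb' := hG.isThread_iff.1 h'
    -- An even number of rotations gives the same thread, an odd number the opposite sign.
    rcases hG.eq_of_vert_eq hv with rfl | rfl | rfl | rfl
    · exact absurd (Subtype.ext (by change s(_, _) = s(_, _); rw [hb, hb'])) hne
    · rw [hrot, neg_neg]
    · exact absurd (Subtype.ext (by
        change s(_, _) = s(_, _); rw [hb, hb', hG.rot_four, Sym2.eq_swap])) hne
    · simp only [hrot, neg_neg]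
  · intro c hc i
    rw [hυ, hυ, hflip (c.dart (i + 1)), hG.isThread_iff.1 (hC.2 c hc i), hrot, hrot]
    simp

end

end EmbeddedGraph

/-! ### Executing programs -/

namespace RAM

theorem State.reg_setReg (s : State) (d x a : ℕ) :
    (s.setReg d x).reg a = if a = d then x else s.reg a := Function.update_apply _ _ _ _

theorem State.mem_setReg (s : State) (d x : ℕ) : (s.setReg d x).mem = s.mem := rfl

theorem State.reg_setMem (s : State) (d x : ℕ) : (s.setMem d x).reg = s.reg := rfl

theorem State.mem_setMem (s : State) (d x a : ℕ) :
    (s.setMem d x).mem a = if a = d then x else s.mem a := Function.update_apply _ _ _ _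

variable {B : ℕ} {s : State}

/-- These variants take the computed value as a separate variable, so that intermediate states can
be written in closed form beforehand. -/
theorem Exec.copy_of_eq {d a x : ℕ} (h : s.reg a = x) :
    Exec B (.copy d a) s (s.setReg d x) 1 := h ▸ Exec.copy s d a

theorem Exec.add_of_eq {d a b x : ℕ} (h : s.reg a + s.reg b = x) (hx : x ≤ B) :
    Exec B (.add d a b) s (s.setReg d x) 1 := by
  subst h; exact Exec.add s d a b hx

theorem Exec.sub_of_eq {d a b x : ℕ} (h : s.reg a - s.reg b = x) :
    Exec B (.sub d a b) s (s.setReg d x) 1 := h ▸ Exec.sub s d a b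

theorem Exec.load_of_eq {d a x : ℕ} (h : s.mem (s.reg a) = x) :
    Exec B (.load d a) s (s.setReg d x) 1 := h ▸ Exec.load s d a

theorem Exec.store_of_eq {a b x y : ℕ} (ha : s.reg a = x) (hb : s.reg b = y) :
    Exec B (.store a b) s (s.setMem x y) 1 := ha ▸ hb ▸ Exec.store s a b

end RAM

namespace EmbeddedGraph

open RAM

/-! ### Codes of half-edges -/

section

variable {n m : ℕ}

theorem code_lt (h : HalfEdge (Fin m)) : code h < 2 * m := by
  have := h.1.2
  unfold code
  split <;> omega

@[simp] theorem code_false (e : Fin m) : code (e, false) = e := rfl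

@[simp] theorem code_true (e : Fin m) : code (e, true) = m + e := rfl

/-- Makes the comparison of two registers a test for the return to the first half-edge of a circuit.
-/
theorem code_eq_iff {h : HalfEdge (Fin m)} {e : Fin m} : code h = e ↔ h = (e, false) := by
  obtain ⟨e', _ | _⟩ := h
  · simp [Fin.ext_iff]
  · have := e.2
    simp only [code_true, Prod.mk.injEq, reduceCtorEq, and_false, iff_false]
    omega

theorem length_halfEdges : (halfEdges m).length = 2 * m := by
  simp [halfEdges, two_mul]

theorem getElem?_halfEdges (h : HalfEdge (Fin m)) : (halfEdges m)[code h]? = some h := by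
  obtain ⟨e, _ | _⟩ := h
  · simp [halfEdges, List.getElem?_append_left]
  · simp [halfEdges]

theorem input_length (G : EmbeddedGraph (Fin n) (Fin m)) : G.input.length = 2 + 4 * m := by
  simp only [input, List.length_cons, List.length_append, List.length_map, length_halfEdges]
  ring

theorem initial_input_rot (G : EmbeddedGraph (Fin n) (Fin m)) (h : HalfEdge (Fin m)) :
    (initial G.input).mem (2 + code h) = code (G.rot h) := by
  have := code_lt h
  simp only [initial, input, add_comm 2, List.getD_eq_getElem?_getD, List.getElem?_cons_succ]
  rw [List.getElem?_append_left (by simpa [length_halfEdges] using this), List.getElem?_map,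
    getElem?_halfEdges]
  rfl

/-- The marks lie past the input, so all edges are unmarked without initialisation. -/
theorem initial_input_of_le (G : EmbeddedGraph (Fin n) (Fin m)) {a : ℕ} (ha : 2 + 4 * m ≤ a) :
    (initial G.input).mem a = 0 := by
  simp [initial, List.getElem?_eq_none (by rw [input_length]; exact ha : G.input.length ≤ a)]

end

/-! ### The program

Registers: `0` address of the output, `1` number of edges, `2` and `3` the constants one and two,
`4` address of the marks of the edges, `5` edge under consideration, `6` end of the output,
`7` current half-edge, `8` address of the length of the current circuit, `9` number of circuits,
`12` distance of the current half-edge from the first one, `13` the constant zero; the others are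
auxiliary. -/

/-- Find the edge and the other end of the current half-edge. -/
def flipProgram : Program :=
  .ifLt 7 1 (.seq (.copy 10 7) (.add 11 7 1)) (.seq (.sub 10 7 1) (.copy 11 10))

/-- List the current half-edge, mark its edge, and follow the thread. -/
def stepProgram : Program :=
  .seq (.store 6 7) <| .seq (.add 6 6 2) <| .seq flipProgram <| .seq (.add 10 4 10) <|
  .seq (.store 10 2) <| .seq (.add 11 3 11) <| .seq (.load 11 11) <| .seq (.add 11 3 11) <|
  -- One of the two truncated differences is zero, so their sum is the absolute difference.
  .seq (.load 7 11) <| .seq (.sub 10 7 5) <| .seq (.sub 12 5 7) (.add 12 10 12)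

/-- List the circuit that starts with the edge under consideration. -/
def circuitProgram : Program :=
  -- The length is still unknown, so its cell is reserved and filled in at the end. Register `12`
  -- starts with a nonzero value so that the loop is entered at the first half-edge.
  .seq (.copy 8 6) <| .seq (.store 8 13) <| .seq (.add 6 6 2) <| .seq (.copy 7 5) <|
  .seq (.const 12 1) <| .seq (.whileLt 13 12 stepProgram) <| .seq (.sub 10 6 8) <|
  .seq (.sub 10 10 2) <| .seq (.store 8 10) (.add 9 9 2)

/-- List the circuit of the edge under consideration unless it is marked; go to the next edge. -/
def edgeProgram : Program :=
  .seq (.add 10 4 5) <| .seq (.load 14 10) <| .seq (.ifLt 14 2 circuitProgram .skip) (.add 5 5 2)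

/-- Set up the registers. -/
def setupProgram : Program :=
  -- Register `2` also serves as the address of `m` in the input. The `2 + 4 * m` input cells are
  -- followed by `m` marks, then by the output.
  .seq (.const 2 1) <| .seq (.const 3 2) <| .seq (.load 1 2) <| .seq (.add 4 3 1) <|
  .seq (.add 4 4 1) <| .seq (.add 4 4 1) <| .seq (.add 4 4 1) <| .seq (.add 0 4 1) (.add 6 0 2)

/-- List the threaded circuit partition. -/
def partitionProgram : Program :=
  .seq setupProgram <| .seq (.whileLt 5 1 edgeProgram) (.store 0 9)

/-! ### Correctness and running time -/

section

variable {n m : ℕ}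

/-- The constant registers, the input, the marks of the edges in `vis`, and the output `out`
except for its first entry. -/
structure Represents (G : EmbeddedGraph (Fin n) (Fin m)) (s : State) (vis : Set (Fin m))
    (out : List ℕ) : Prop where
  reg0 : s.reg 0 = 2 + 5 * m
  reg1 : s.reg 1 = m
  reg2 : s.reg 2 = 1
  reg3 : s.reg 3 = 2
  reg4 : s.reg 4 = 2 + 4 * m
  -- The cell `2 + 5 * m` is kept for the number of circuits.
  reg6 : s.reg 6 = 3 + 5 * m + out.length
  reg13 : s.reg 13 = 0
  rot : ∀ h, s.mem (2 + code h) = code (G.rot h)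
  marked : ∀ e ∈ vis, s.mem (2 + 4 * m + (e : ℕ)) = 1
  unmarked : ∀ e ∉ vis, s.mem (2 + 4 * m + (e : ℕ)) = 0
  out : ∀ i (hi : i < out.length), s.mem (3 + 5 * m + i) = out[i]

variable {G : EmbeddedGraph (Fin n) (Fin m)} {s : State} {vis : Set (Fin m)} {out : List ℕ} {B : ℕ}

theorem Represents.congr {s' : State} (hs : G.Represents s vis out) (hmem : s'.mem = s.mem)
    (hreg : ∀ i ∈ [0, 1, 2, 3, 4, 6, 13], s'.reg i = s.reg i) : G.Represents s' vis out := by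
  simp only [List.forall_mem_cons] at hreg
  obtain ⟨h0, h1, h2, h3, h4, h6, h13, -⟩ := hreg
  constructor
  · rw [h0, hs.reg0]
  · rw [h1, hs.reg1]
  · rw [h2, hs.reg2]
  · rw [h3, hs.reg3]
  · rw [h4, hs.reg4]
  · rw [h6, hs.reg6]
  · rw [h13, hs.reg13]
  · rw [hmem]; exact hs.rot
  · rw [hmem]; exact hs.marked
  · rw [hmem]; exact hs.unmarked
  · rw [hmem]; exact hs.out

/-- Append a number to the output. -/
theorem Represents.append {s' : State} {x : ℕ} (hs : G.Represents s vis out)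
    (hmem : s'.mem = (s.setMem (3 + 5 * m + out.length) x).mem)
    (hreg : ∀ i ∈ [0, 1, 2, 3, 4, 13], s'.reg i = s.reg i)
    (hreg6 : s'.reg 6 = 3 + 5 * m + out.length + 1) : G.Represents s' vis (out ++ [x]) := by
  simp only [List.forall_mem_cons] at hreg
  obtain ⟨h0, h1, h2, h3, h4, h13, -⟩ := hreg
  constructor
  · rw [h0, hs.reg0]
  · rw [h1, hs.reg1]
  · rw [h2, hs.reg2]
  · rw [h3, hs.reg3]
  · rw [h4, hs.reg4]
  · rw [hreg6, List.length_append, List.length_singleton, add_assoc]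
  · rw [h13, hs.reg13]
  · intro h
    have := code_lt h
    rw [hmem, State.mem_setMem, if_neg (by omega), hs.rot]
  · intro e he
    have := e.2
    rw [hmem, State.mem_setMem, if_neg (by omega), hs.marked e he]
  · intro e he
    have := e.2
    rw [hmem, State.mem_setMem, if_neg (by omega), hs.unmarked e he]
  · intro i hi
    rw [hmem, State.mem_setMem]
    rw [List.length_append, List.length_singleton] at hi
    rcases Nat.lt_succ_iff_lt_or_eq.1 hi with h | rfl
    · rw [if_neg (by omega), hs.out i h, List.getElem_append_left h]
    · simp

/-- Mark an edge. -/
theorem Represents.mark {s' : State} {e : Fin m} (hs : G.Represents s vis out)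
    (hmem : s'.mem = (s.setMem (2 + 4 * m + (e : ℕ)) 1).mem)
    (hreg : ∀ i ∈ [0, 1, 2, 3, 4, 6, 13], s'.reg i = s.reg i) :
    G.Represents s' (insert e vis) out := by
  simp only [List.forall_mem_cons] at hreg
  obtain ⟨h0, h1, h2, h3, h4, h6, h13, -⟩ := hreg
  have he2 := e.2
  constructor
  · rw [h0, hs.reg0]
  · rw [h1, hs.reg1]
  · rw [h2, hs.reg2]
  · rw [h3, hs.reg3]
  · rw [h4, hs.reg4]
  · rw [h6, hs.reg6]
  · rw [h13, hs.reg13]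
  · intro h
    have := code_lt h
    rw [hmem, State.mem_setMem, if_neg (by omega), hs.rot]
  · intro e' he
    rw [hmem, State.mem_setMem]
    split_ifs with h
    · rfl
    · exact hs.marked e' (he.resolve_left fun h' => h (by rw [h']))
  · intro e' he
    rw [Set.mem_insert_iff, not_or] at he
    rw [hmem, State.mem_setMem, if_neg (fun h => he.1 (Fin.ext (by omega))),
      hs.unmarked e' he.2]
  · intro i hi
    rw [hmem, State.mem_setMem, if_neg (by omega), hs.out i hi]

/-- Change a number in the output. -/
theorem Represents.set {s' : State} {i x : ℕ} (hs : G.Represents s vis out)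
    (hmem : s'.mem = (s.setMem (3 + 5 * m + i) x).mem)
    (hreg : ∀ i ∈ [0, 1, 2, 3, 4, 6, 13], s'.reg i = s.reg i) :
    G.Represents s' vis (out.set i x) := by
  simp only [List.forall_mem_cons] at hreg
  obtain ⟨h0, h1, h2, h3, h4, h6, h13, -⟩ := hreg
  constructor
  · rw [h0, hs.reg0]
  · rw [h1, hs.reg1]
  · rw [h2, hs.reg2]
  · rw [h3, hs.reg3]
  · rw [h4, hs.reg4]
  · rw [h6, hs.reg6, List.length_set]
  · rw [h13, hs.reg13]
  · intro h
    have := code_lt h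
    rw [hmem, State.mem_setMem, if_neg (by omega), hs.rot]
  · intro e he
    have := e.2
    rw [hmem, State.mem_setMem, if_neg (by omega), hs.marked e he]
  · intro e he
    have := e.2
    rw [hmem, State.mem_setMem, if_neg (by omega), hs.unmarked e he]
  · intro j hj
    rw [List.length_set] at hj
    rw [hmem, State.mem_setMem, List.getElem_set]
    by_cases h : i = j
    · rw [if_pos (by omega), if_pos h]
    · rw [if_neg (by omega), if_neg h, hs.out j hj]

theorem exec_flipProgram {h : HalfEdge (Fin m)} (h1 : s.reg 1 = m) (h7 : s.reg 7 = code h)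
    (hB : 2 * m ≤ B) :
    Exec B flipProgram s ((s.setReg 10 h.1).setReg 11 (code h.flip)) 3 := by
  obtain ⟨e, _ | _⟩ := h
  · have := e.2
    have h7' : s.reg 7 = e := h7
    refine .ifTrue _ (by omega) (.seq (.copy_of_eq h7) (.add_of_eq ?_ ?_))
    · simp [State.reg_setReg, h1, h7', HalfEdge.flip, add_comm]
    · simp only [HalfEdge.flip, Bool.not_false, code_true]; omega
  · have := e.2
    have h7' : s.reg 7 = m + e := h7
    refine .ifFalse _ (by omega) (.seq (.sub_of_eq ?_) (.copy_of_eq ?_))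
    · simp [h1, h7']
    · simp [State.reg_setReg, HalfEdge.flip]

/-- The bound on `out.length` keeps the output addresses at most `7 * m + 3`, hence below the
permitted size. -/
theorem exec_stepProgram (hs : G.Represents s vis out) (hB : 10 * (m + 1) ≤ B)
    {h : HalfEdge (Fin m)} {e : Fin m} (h7 : s.reg 7 = code h) (h5 : s.reg 5 = e)
    (hlen : out.length < 2 * m) :
    ∃ s', Exec B stepProgram s s' 14 ∧ G.Represents s' (insert h.1 vis) (out ++ [code h]) ∧
      s'.reg 7 = code (G.next h) ∧
      (s'.reg 12 = 0 ↔ G.next h = (e, false)) ∧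
      ∀ i ∈ [5, 8, 9], s'.reg i = s.reg i := by
  have he := e.2
  have hh := h.1.2
  have hc1 := code_lt h.flip
  have hc2 := code_lt (G.rot h.flip)
  have hc3 := code_lt (G.next h)
  let s1 := (s.setMem (3 + 5 * m + out.length) (code h)).setReg 6 (3 + 5 * m + out.length + 1)
  have hs1 : G.Represents s1 vis (out ++ [code h]) := by
    refine hs.append rfl ?_ ?_
    · simp [s1, State.reg_setReg, State.reg_setMem]
    · simp [s1, State.reg_setReg]
  let s2 := (s1.setReg 10 h.1).setReg 11 (code h.flip)
  let s3 := (s2.setReg 10 (2 + 4 * m + h.1)).setMem (2 + 4 * m + h.1) 1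
  have hs3 : G.Represents s3 (insert h.1 vis) (out ++ [code h]) := by
    refine hs1.mark rfl ?_
    simp [s3, s2, State.reg_setReg, State.reg_setMem]
  let s4 := s3.setReg 11 (2 + code h.flip)
  let s5 := s4.setReg 11 (code (G.rot h.flip))
  let s6 := s5.setReg 11 (2 + code (G.rot h.flip))
  let s7 := s6.setReg 7 (code (G.next h))
  let s8 := s7.setReg 10 (code (G.next h) - e)
  let s9 := s8.setReg 12 (e - code (G.next h))
  let s10 := s9.setReg 12 (code (G.next h) - e + (e - code (G.next h)))
  have hs10 : G.Represents s10 (insert h.1 vis) (out ++ [code h]) := by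
    refine hs3.congr rfl ?_
    simp [s10, s9, s8, s7, s6, s5, s4, State.reg_setReg]
  refine ⟨s10, ?_, hs10, ?_, ?_, ?_⟩
  · refine .seq (t' := 13) (.store_of_eq hs.reg6 h7) <| .seq (t' := 12) (.add_of_eq
      (x := 3 + 5 * m + out.length + 1) ?_ ?_) <|
      .seq (t' := 9) (exec_flipProgram (s := s1) (h := h) hs1.reg1 ?_ ?_) <|
      .seq (t' := 8) (.add_of_eq (x := 2 + 4 * m + h.1) ?_ ?_) <|
      .seq (t' := 7) (.store_of_eq (x := 2 + 4 * m + h.1) (y := 1) ?_ ?_) <|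
      .seq (t' := 6) (.add_of_eq (s := s3) (x := 2 + code h.flip) ?_ ?_) <|
      .seq (t' := 5) (.load_of_eq (s := s4) (x := code (G.rot h.flip)) ?_) <|
      .seq (t' := 4) (.add_of_eq (s := s5) (x := 2 + code (G.rot h.flip)) ?_ ?_) <|
      .seq (t' := 3) (.load_of_eq (s := s6) (x := code (G.next h)) ?_) <|
      .seq (t' := 2) (.sub_of_eq (s := s7) (x := code (G.next h) - e) ?_) <|
      .seq (.sub_of_eq (s := s8) (x := e - code (G.next h)) ?_)
      (.add_of_eq (s := s9) (x := code (G.next h) - e + (e - code (G.next h))) ?_ ?_)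
    · simp [State.reg_setMem, hs.reg6, hs.reg2]
    · omega
    · simp [s1, State.reg_setReg, State.reg_setMem, h7]
    · omega
    · simp [s1, State.reg_setReg, State.reg_setMem, hs.reg4]
    · omega
    · simp [State.reg_setReg]
    · simp [s1, State.reg_setReg, State.reg_setMem, hs.reg2]
    · rw [hs3.reg3]; simp [s3, s2, State.reg_setReg, State.reg_setMem]
    · omega
    · rw [show s4.reg 11 = 2 + code h.flip by simp [s4, State.reg_setReg]]
      exact hs3.rot h.flip
    · rw [show s5.reg 3 = s3.reg 3 by simp [s5, s4, State.reg_setReg], hs3.reg3]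
      simp [s5, State.reg_setReg]
    · omega
    · rw [show s6.reg 11 = 2 + code (G.rot h.flip) by simp [s6, State.reg_setReg]]
      exact hs3.rot (G.rot h.flip)
    · simp [s7, s6, s5, s4, s3, s2, s1, State.reg_setReg, State.reg_setMem, h5]
    · simp [s8, s7, s6, s5, s4, s3, s2, s1, State.reg_setReg, State.reg_setMem, h5]
    · simp [s9, s8, State.reg_setReg]
    · omega
  · simp [s10, s9, s8, s7, State.reg_setReg]
  · rw [← code_eq_iff, show s10.reg 12 = code (G.next h) - e + (e - code (G.next h)) by
      simp [s10, State.reg_setReg]]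
    omega
  · simp [s10, s9, s8, s7, s6, s5, s4, s3, s2, s1, State.reg_setReg, State.reg_setMem]

/-- The target `(e, false)` stays fixed while `h` moves towards it in `r + 1` rounds. A round costs
14 steps and a test, and leaving the loop costs one more test. -/
theorem exec_while_stepProgram (hB : 10 * (m + 1) ≤ B) {e : Fin m} (r : ℕ) :
    ∀ {s : State} {vis : Set (Fin m)} {out : List ℕ} {h : HalfEdge (Fin m)},
      G.Represents s vis out → s.reg 7 = code h → s.reg 5 = e → s.reg 12 ≠ 0 →
      (∀ i, 0 < i → i ≤ r → G.next^[i] h ≠ (e, false)) → G.next^[r + 1] h = (e, false) →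
      out.length + (r + 1) ≤ 2 * m →
      ∃ s', Exec B (.whileLt 13 12 stepProgram) s s' (15 * (r + 1) + 1) ∧
        G.Represents s' (vis ∪ {e | e ∈ (List.iterate G.next h (r + 1)).map Prod.fst})
          (out ++ (List.iterate G.next h (r + 1)).map code) ∧
        ∀ i ∈ [5, 8, 9], s'.reg i = s.reg i := by
  induction r with
  | zero =>
    intro s vis out h hs h7 h5 h12 _ hend hlen
    obtain ⟨s', hx, hs', -, h12', hreg⟩ := exec_stepProgram hs hB h7 h5 (by omega)
    refine ⟨s', ?_, ?_, hreg⟩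
    · have h0 := h12'.2 hend
      refine .whileTrue (t := 14) (t' := 1) ?_ hx (.whileFalse _ ?_)
      · rw [hs.reg13]; omega
      · rw [h0]; omega
    · convert hs' using 1
      · ext x
        simp [or_comm]
      · rfl
  | succ r ih =>
    intro s vis out h hs h7 h5 h12 hne hend hlen
    obtain ⟨s₁, hx, hs₁, h7₁, h12₁, hreg₁⟩ := exec_stepProgram hs hB h7 h5 (by omega)
    have h5₁ : s₁.reg 5 = e := by rw [hreg₁ 5 (by simp), h5]
    obtain ⟨s', hx', hs', hreg'⟩ := ih hs₁ h7₁ h5₁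
      (fun H => hne 1 one_pos (by omega) (h12₁.1 H))
      (fun i hi hir => by
        rw [← Function.iterate_succ_apply]; exact hne _ (by omega) (by omega))
      (by rw [← Function.iterate_succ_apply]; exact hend)
      (by rw [List.length_append, List.length_singleton]; omega)
    refine ⟨s', ?_, ?_, fun i hi => (hreg' i hi).trans (hreg₁ i hi)⟩
    · convert Exec.whileTrue (a := 13) (b := 12) (by rw [hs.reg13]; omega) hx hx' using 1
      ring
    · convert hs' using 1
      · ext x
        rw [List.iterate]
        simp only [Set.mem_union, Set.mem_ofPred_eq, List.map_cons, List.mem_cons,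
          Set.mem_insert_iff]
        tauto
      · rw [List.iterate, List.map_cons, List.append_assoc, List.singleton_append]

theorem orbit_eq_iterate (G : EmbeddedGraph (Fin n) (Fin m)) (h : HalfEdge (Fin m)) :
    G.orbit h = List.iterate G.next h (Function.minimalPeriod G.next h) :=
  List.range_map_iterate _ _ _

theorem exec_circuitProgram (hs : G.Represents s vis out) (hB : 10 * (m + 1) ≤ B) {e : Fin m}
    (h5 : s.reg 5 = e) (hlen : out.length + 1 + (G.orbit (e, false)).length ≤ 2 * m)
    (h9 : s.reg 9 ≤ m) :
    ∃ s', Exec B circuitProgram s s' (15 * (G.orbit (e, false)).length + 10) ∧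
      G.Represents s' (vis ∪ {e' | e' ∈ (G.orbit (e, false)).map Prod.fst})
        (out ++ ((G.orbit (e, false)).length :: (G.orbit (e, false)).map code)) ∧
      s'.reg 5 = e ∧ s'.reg 9 = s.reg 9 + 1 := by
  obtain ⟨r, hr⟩ : ∃ r, Function.minimalPeriod G.next (e, false) = r + 1 :=
    Nat.exists_eq_succ_of_ne_zero (G.minimalPeriod_next_pos _).ne'
  rw [orbit_eq_iterate, hr, List.length_iterate] at hlen ⊢
  let s1 := (s.setReg 8 (3 + 5 * m + out.length)).setMem (3 + 5 * m + out.length) 0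
  let s2 := s1.setReg 6 (3 + 5 * m + out.length + 1)
  let s3 := s2.setReg 7 e
  let s4 := s3.setReg 12 1
  have hs4 : G.Represents s4 vis (out ++ [0]) := by
    refine hs.append rfl ?_ ?_
    · simp [s4, s3, s2, s1, State.reg_setReg, State.reg_setMem]
    · simp [s4, s3, s2, State.reg_setReg]
  obtain ⟨s5, hx5, hs5, hreg5⟩ := exec_while_stepProgram hB (e := e) r (h := (e, false)) hs4
    (by simp [s4, s3, State.reg_setReg])
    (by simp [s4, s3, s2, s1, State.reg_setReg, State.reg_setMem, h5])
    (by simp [s4, State.reg_setReg])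
    -- A return before the minimal period is impossible.
    (fun i hi hir H => by
      have := Function.IsPeriodicPt.minimalPeriod_le hi (f := G.next) H
      omega)
    (by rw [← hr, Function.iterate_minimalPeriod])
    (by rw [List.length_append, List.length_singleton]; omega)
  have r5 : s5.reg 5 = e := by
    rw [hreg5 5 (by simp)]; simp [s4, s3, s2, s1, State.reg_setReg, State.reg_setMem, h5]
  have r8 : s5.reg 8 = 3 + 5 * m + out.length := by
    rw [hreg5 8 (by simp)]; simp [s4, s3, s2, s1, State.reg_setReg, State.reg_setMem]
  have r9 : s5.reg 9 = s.reg 9 := by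
    rw [hreg5 9 (by simp)]; simp [s4, s3, s2, s1, State.reg_setReg, State.reg_setMem]
  have r6 := hs5.reg6
  simp only [List.length_append, List.length_singleton, List.length_map,
    List.length_iterate] at r6
  -- The distance from the length cell to the end of the output includes that cell, hence `r + 2`
  -- for `r + 1` edges.
  let s6 := s5.setReg 10 (r + 2)
  let s7 := s6.setReg 10 (r + 1)
  let s8 := s7.setMem (3 + 5 * m + out.length) (r + 1)
  let s9 := s8.setReg 9 (s.reg 9 + 1)
  refine ⟨s9, ?_, ?_, ?_, ?_⟩
  · have htime : 15 * (r + 1) + 10 = 1 + (1 + (1 + (1 + (1 + (15 * (r + 1) + 1 +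
      (1 + (1 + (1 + 1)))))))) := by ring
    rw [htime]
    refine .seq (.copy_of_eq hs.reg6) <| .seq (.store_of_eq (x := 3 + 5 * m + out.length)
      (y := 0) ?_ ?_) <| .seq (.add_of_eq (s := s1) (x := 3 + 5 * m + out.length + 1) ?_ ?_) <|
      .seq (.copy_of_eq (s := s2) (x := e) ?_) <| .seq (.const _ _ _ ?_) <| .seq hx5 <|
      .seq (.sub_of_eq (x := r + 2) ?_) <| .seq (.sub_of_eq (s := s6) (x := r + 1) ?_) <|
      .seq (.store_of_eq (s := s7) (x := 3 + 5 * m + out.length) (y := r + 1) ?_ ?_)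
      (.add_of_eq (s := s8) (x := s.reg 9 + 1) ?_ ?_)
    · simp [State.reg_setReg]
    · simp [State.reg_setReg, hs.reg13]
    · simp [s1, State.reg_setReg, State.reg_setMem, hs.reg6, hs.reg2]
    · omega
    · simp [s2, s1, State.reg_setReg, State.reg_setMem, h5]
    · omega
    · rw [r6, r8]; omega
    · simp [s6, State.reg_setReg, hs5.reg2]
    · simp [s7, s6, State.reg_setReg, r8]
    · simp [s7, State.reg_setReg]
    · simp [s8, s7, s6, State.reg_setReg, State.reg_setMem, r9, hs5.reg2]
    · omega
  · have hs9 := hs5.set (s' := s9) (i := out.length) (x := r + 1) rfl (by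
      simp [s9, s8, s7, s6, State.reg_setReg, State.reg_setMem])
    convert hs9 using 1
    rw [List.append_assoc, List.set_append_right _ _ le_rfl, Nat.sub_self]
    rfl
  · simp [s9, s8, s7, s6, State.reg_setReg, State.reg_setMem, r5]
  · simp [s9, State.reg_setReg]

end

end EmbeddedGraph

/-! ### The loop over all edges and its amortised running time -/

namespace EmbeddedGraph

open RAM

section

variable {n m : ℕ} {G : EmbeddedGraph (Fin n) (Fin m)} {B : ℕ}

/-- The edges of the circuits in a list. -/
def edgesOf (L : List G.Circuit) : List (Fin m) := L.flatMap fun c => c.darts.map Prod.fst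

/-- The output for a list of circuits except for its first entry. -/
def listing (L : List G.Circuit) : List ℕ :=
  L.flatMap fun c => c.darts.length :: c.darts.map code

theorem edgesOf_concat (L : List G.Circuit) (c : G.Circuit) :
    edgesOf (L ++ [c]) = edgesOf L ++ c.darts.map Prod.fst := by
  simp [edgesOf]

theorem listing_concat (L : List G.Circuit) (c : G.Circuit) :
    listing (L ++ [c]) = listing L ++ (c.darts.length :: c.darts.map code) := by
  simp [listing]

theorem length_listing (L : List G.Circuit) :
    (listing L).length = L.length + (edgesOf L).length := by
  induction L with
  | nil => rfl
  | cons c L ih =>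
    simp only [listing, edgesOf, List.flatMap_cons, List.length_append, List.length_cons,
      List.length_map] at ih ⊢
    omega

/-- Circuits are non-empty. With distinct edges this leaves at most `m` circuits and a listing of at
most `2 * m` numbers, so addresses remain linear. -/
theorem length_le_length_edgesOf (L : List G.Circuit) : L.length ≤ (edgesOf L).length := by
  induction L with
  | nil => rfl
  | cons c L ih =>
    have := List.length_pos_of_ne_nil c.ne_nil
    simp only [edgesOf, List.flatMap_cons, List.length_append, List.length_cons,
      List.length_map] at ih ⊢
    omega

theorem length_le_of_nodup {l : List (Fin m)} (hl : l.Nodup) : l.length ≤ m := by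
  simpa using hl.length_le_card

theorem nodup_map_free_of_nodup_edgesOf {L : List G.Circuit} (hL : (edgesOf L).Nodup) :
    (L.map Circuit.free).Nodup := by
  rw [List.Nodup, List.pairwise_map]
  refine (List.nodup_flatMap.1 hL).2.imp ?_
  intro c c' hdisj hfree
  obtain ⟨d, hd⟩ := List.exists_mem_of_ne_nil _ c.ne_nil
  have he : d.1 ∈ c.darts.map Prod.fst := List.mem_map_of_mem hd
  exact hdisj he ((Circuit.free_eq_iff.1 hfree).mem_edges_iff.1 he)

/-- Consider an edge after the circuits in `L` have been found. -/
theorem IsFourRegular.exec_edgeProgram (hG : G.IsFourRegular) (hB : 10 * (m + 1) ≤ B) {s : State}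
    {L : List G.Circuit} (hs : G.Represents s {e | e ∈ edgesOf L} (listing L))
    (h9 : s.reg 9 = L.length) (hT : ∀ c ∈ L, c.IsThreaded) (hN : (edgesOf L).Nodup) {e : Fin m}
    (h5 : s.reg 5 = e) :
    ∃ (s' : State) (t : ℕ) (L' : List G.Circuit), Exec B edgeProgram s s' t ∧
      -- Amortised count: 15 steps are charged to each newly listed edge and at most 14 to the edge
      -- under consideration.
      t + 15 * (edgesOf L).length ≤ 15 * (edgesOf L').length + 14 ∧
      G.Represents s' {e | e ∈ edgesOf L'} (listing L') ∧ s'.reg 9 = L'.length ∧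
      s'.reg 5 = e + 1 ∧ (∀ c ∈ L', c.IsThreaded) ∧ (edgesOf L').Nodup ∧
      edgesOf L ⊆ edgesOf L' ∧ e ∈ edgesOf L' := by
  have he := e.2
  by_cases hvis : e ∈ edgesOf L
  · let s1 := s.setReg 10 (2 + 4 * m + e)
    let s2 := s1.setReg 14 1
    let s3 := s2.setReg 5 (e + 1)
    refine ⟨s3, 1 + (1 + (1 + 1 + 1)), L, ?_, by omega, ?_, ?_, ?_, hT, hN,
      List.Subset.refl _, hvis⟩
    · refine .seq (.add_of_eq (x := 2 + 4 * m + e) ?_ ?_) <|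
        .seq (.load_of_eq (s := s1) (x := 1) ?_) <|
        .seq (.ifFalse (s := s2) _ ?_ (.skip _)) (.add_of_eq (x := e + 1) ?_ ?_)
      · rw [hs.reg4, h5]
      · omega
      · rw [show s1.reg 10 = 2 + 4 * m + e by simp [s1, State.reg_setReg]]
        exact hs.marked e hvis
      · simp [s2, s1, State.reg_setReg, hs.reg2]
      · simp [s2, s1, State.reg_setReg, hs.reg2, h5]
      · omega
    · refine hs.congr rfl ?_
      simp [s3, s2, s1, State.reg_setReg]
    · simp [s3, s2, s1, State.reg_setReg, h9]
    · simp [s3, State.reg_setReg]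
  · let c := hG.circuit (e, false)
    have hc : c.IsThreaded := hG.isThreaded_of_darts_eq rfl
    have hec : e ∈ c.darts.map Prod.fst :=
      List.mem_map.2 ⟨(e, false), mem_orbit.2 ⟨0, rfl⟩, rfl⟩
    have hT' : ∀ c' ∈ L ++ [c], c'.IsThreaded := by
      intro c' hc'
      rcases List.mem_append.1 hc' with h | h
      · exact hT c' h
      · rw [List.mem_singleton.1 h]; exact hc
    have hN' : (edgesOf (L ++ [c])).Nodup := by
      rw [edgesOf_concat]
      -- An earlier circuit sharing an edge with the new one would be the same circuit and would
      -- already contain `e`.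
      refine hN.append c.edges_nodup fun e' he' hec' => hvis ?_
      obtain ⟨c', hc', hec''⟩ := List.mem_flatMap.1 he'
      exact List.mem_flatMap.2 ⟨c', hc',
        (hG.same_of_common_edge hc (hT c' hc') hec' hec'').mem_edges_iff.1 hec⟩
    have hm := length_le_of_nodup hN'
    have hm' := hm
    rw [edgesOf_concat, List.length_append, List.length_map] at hm'
    have hll := length_le_length_edgesOf L
    have hpos := List.length_pos_of_ne_nil c.ne_nil
    let s1 := s.setReg 10 (2 + 4 * m + e)
    let s2 := s1.setReg 14 0
    have hs2 : G.Represents s2 {e | e ∈ edgesOf L} (listing L) := by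
      refine hs.congr rfl ?_
      simp [s2, s1, State.reg_setReg]
    have h92 : s2.reg 9 = L.length := by simp [s2, s1, State.reg_setReg, h9]
    obtain ⟨s3, hx, hs3, h53, h93⟩ := exec_circuitProgram hs2 hB (e := e)
      (by simp [s2, s1, State.reg_setReg, h5])
      (by
        change (listing L).length + 1 + c.darts.length ≤ _
        rw [length_listing]
        omega)
      (by omega)
    let s4 := s3.setReg 5 (e + 1)
    refine ⟨s4, 1 + (1 + (15 * c.darts.length + 10 + 1 + 1)), L ++ [c], ?_, ?_, ?_, ?_, ?_, hT',
      hN', ?_, ?_⟩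
    · refine .seq (.add_of_eq (x := 2 + 4 * m + e) ?_ ?_) <|
        .seq (.load_of_eq (s := s1) (x := 0) ?_) <|
        .seq (.ifTrue (s := s2) _ ?_ hx) (.add_of_eq (x := e + 1) ?_ ?_)
      · rw [hs.reg4, h5]
      · omega
      · rw [show s1.reg 10 = 2 + 4 * m + e by simp [s1, State.reg_setReg]]
        exact hs.unmarked e hvis
      · rw [hs2.reg2]; simp [s2, State.reg_setReg]
      · rw [h53, hs3.reg2]
      · omega
    · rw [edgesOf_concat, List.length_append, List.length_map]
      omega
    · rw [listing_concat]
      refine Represents.congr (s := s3) ?_ rfl ?_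
      · convert hs3 using 1
        · ext x
          rw [edgesOf_concat]
          exact List.mem_append
        · rfl
      · simp [s4, State.reg_setReg]
    · simp [s4, State.reg_setReg, h93, h92]
    · simp [s4, State.reg_setReg]
    · rw [edgesOf_concat]; exact List.subset_append_left _ _
    · rw [edgesOf_concat]; exact List.mem_append_right _ hec

/-- Here `k` is the next edge and `r` the number of edges left. The loop test raises the 14 steps
per edge to 15, and the charges to newly listed edges telescope. -/
theorem IsFourRegular.exec_while_edgeProgram (hG : G.IsFourRegular) (hB : 10 * (m + 1) ≤ B)
    (r : ℕ) : ∀ {s : State} {L : List G.Circuit} {k : ℕ}, k + r = m →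
      G.Represents s {e | e ∈ edgesOf L} (listing L) → s.reg 9 = L.length →
      (∀ c ∈ L, c.IsThreaded) → (edgesOf L).Nodup → s.reg 5 = k →
      (∀ e : Fin m, (e : ℕ) < k → e ∈ edgesOf L) →
      ∃ (s' : State) (t : ℕ) (L' : List G.Circuit), Exec B (.whileLt 5 1 edgeProgram) s s' t ∧
        t + 15 * (edgesOf L).length ≤ 15 * (edgesOf L').length + 15 * r + 1 ∧
        G.Represents s' {e | e ∈ edgesOf L'} (listing L') ∧ s'.reg 9 = L'.length ∧
        (∀ c ∈ L', c.IsThreaded) ∧ (edgesOf L').Nodup ∧ ∀ e : Fin m, e ∈ edgesOf L' := by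
  induction r with
  | zero =>
    intro s L k hk hs h9 hT hN h5 hcov
    refine ⟨s, 1, L, .whileFalse _ ?_, by omega, hs, h9, hT, hN, fun e => hcov e ?_⟩
    · rw [h5, hs.reg1]; omega
    · have := e.2; omega
  | succ r ih =>
    intro s L k hk hs h9 hT hN h5 hcov
    obtain ⟨s₁, t₁, L₁, hx₁, ht₁, hs₁, h9₁, h5₁, hT₁, hN₁, hsub, hmem⟩ :=
      hG.exec_edgeProgram hB hs h9 hT hN (e := ⟨k, by omega⟩) h5
    obtain ⟨s', t, L', hx, ht, hs', h9', hT', hN', hcov'⟩ :=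
      ih (k := k + 1) (by omega) hs₁ h9₁ hT₁ hN₁ h5₁ fun e he => by
        rcases Nat.lt_succ_iff_lt_or_eq.1 he with h | h
        · exact hsub (hcov e h)
        · rwa [show e = ⟨k, by omega⟩ from Fin.ext h]
    refine ⟨s', t₁ + t + 1, L', .whileTrue ?_ hx₁ hx, by omega, hs', h9', hT', hN', hcov'⟩
    rw [h5, hs.reg1]; omega

theorem exec_setupProgram (G : EmbeddedGraph (Fin n) (Fin m)) (hB : 10 * (m + 1) ≤ B) :
    ∃ s, Exec B setupProgram (initial G.input) s 9 ∧ G.Represents s ∅ [] ∧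
      s.reg 5 = 0 ∧ s.reg 9 = 0 := by
  let s1 := (((initial G.input).setReg 2 1).setReg 3 2).setReg 1 m
  let s2 := (((s1.setReg 4 (2 + m)).setReg 4 (2 + 2 * m)).setReg 4 (2 + 3 * m)).setReg 4 (2 + 4 * m)
  let s3 := (s2.setReg 0 (2 + 5 * m)).setReg 6 (3 + 5 * m)
  have h0 : ∀ a, (initial G.input).reg a = 0 := fun _ => rfl
  refine ⟨s3, ?_, ?_, ?_, ?_⟩
  · refine .seq (t' := 8) (.const _ _ _ ?_) <| .seq (t' := 7) (.const _ _ _ ?_) <|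
      .seq (t' := 6) (.load_of_eq (x := m) ?_) <|
      .seq (t' := 5) (.add_of_eq (s := s1) (x := 2 + m) ?_ ?_) <|
      .seq (t' := 4) (.add_of_eq (x := 2 + 2 * m) ?_ ?_) <|
      .seq (t' := 3) (.add_of_eq (x := 2 + 3 * m) ?_ ?_) <|
      .seq (t' := 2) (.add_of_eq (x := 2 + 4 * m) ?_ ?_) <|
      .seq (.add_of_eq (s := s2) (x := 2 + 5 * m) ?_ ?_) (.add_of_eq (x := 3 + 5 * m) ?_ ?_)
    · omega
    · omega
    · simp [State.reg_setReg, State.mem_setReg, initial, input]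
    · simp [s1, State.reg_setReg]
    · omega
    · simp only [s1, State.reg_setReg]; simp; omega
    · omega
    · simp only [s1, State.reg_setReg]; simp; omega
    · omega
    · simp only [s1, State.reg_setReg]; simp; omega
    · omega
    · simp only [s2, s1, State.reg_setReg]; simp; omega
    · omega
    · simp only [s2, s1, State.reg_setReg]; simp; omega
    · omega
  · constructor
    · simp [s3, State.reg_setReg]
    · simp [s3, s2, s1, State.reg_setReg]
    · simp [s3, s2, s1, State.reg_setReg]
    · simp [s3, s2, s1, State.reg_setReg]
    · simp [s3, s2, State.reg_setReg]
    · simp [s3, State.reg_setReg]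
    · simp [s3, s2, s1, State.reg_setReg, h0]
    · exact fun h => initial_input_rot G h
    · exact fun e he => absurd he (Set.notMem_empty e)
    · exact fun e _ => initial_input_of_le G (by omega)
    · exact fun i hi => absurd hi (Nat.not_lt_zero i)
  · simp [s3, s2, s1, State.reg_setReg, h0]
  · simp [s3, s2, s1, State.reg_setReg, h0]

end

theorem finds_partitionProgram :
    FindsThreadedCircuitPartitionInLinearTime partitionProgram := by
  -- The time is at most `9 + (30 * m + 1) + 1`, and all computed numbers are at most `10 * (m +
  -- 1)`; 40 is ample for both.
  refine ⟨40, fun n m G _ hG => ?_⟩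
  have hB : 10 * (m + 1) ≤ 40 * (n + m + 1) := by omega
  obtain ⟨s₁, hx₁, hs₁, h5, h9⟩ := exec_setupProgram G hB
  obtain ⟨s₂, t, L, hx₂, ht, hs₂, h9₂, hT, hN, hcov⟩ :=
    hG.exec_while_edgeProgram hB m (L := []) (k := 0) (zero_add m)
      (by
        convert hs₁ using 1
        · ext e; simp [edgesOf]
        · rfl) h9 (by simp) List.nodup_nil h5
      (fun e he => absurd he (Nat.not_lt_zero _))
  have hm := length_le_of_nodup hN
  refine ⟨_, 9 + (t + 1), L, .seq hx₁ (.seq hx₂ (.store_of_eq hs₂.reg0 h9₂)), by omega, ?_,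
    nodup_map_free_of_nodup_edgesOf hN, ?_⟩
  · rintro ⟨i, hi⟩
    rw [State.reg_setMem, hs₂.reg0, State.mem_setMem]
    cases i with
    | zero => simp [output]
    | succ i =>
      rw [if_neg (by simp)]
      have hi' : i < (listing L).length := Nat.lt_of_succ_lt_succ hi
      have := hs₂.out i hi'
      rw [show 3 + 5 * m + i = 2 + 5 * m + (i + 1) by ring] at this
      exact this
  · have hthr : ∀ c : G.Circuit, c.free ∈ L.map Circuit.free → c.IsThreaded := by
      intro c hc
      obtain ⟨c', hc', hcc'⟩ := List.mem_map.1 hc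
      exact hG.isThreaded_of_same (hT c' hc') (Circuit.free_eq_iff.1 hcc')
    have heq : {γ | γ ∈ L.map Circuit.free} = G.threadedCircuits := by
      refine hG.eq_threadedCircuits hthr fun e => ?_
      obtain ⟨c, hc, hec⟩ := List.mem_flatMap.1 (hcov e)
      exact ⟨c, List.mem_map_of_mem hc, hec⟩
    rw [heq]
    exact hG.isThreadedCircuitPartition

end EmbeddedGraph

theorem theorem1 :
    (∀ (V : Type u) (E : Type v) [Finite V] [Finite E] (G : EmbeddedGraph V E),
      G.IsPlane → G.IsFourRegular →
        (∃! P : Set G.FreeCircuit, G.IsThreadedCircuitPartition P) ∧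
        ∀ (P : Set G.FreeCircuit) (hP : G.IsThreadedCircuitPartition P),
          ∃ υ : G.UnderOver, υ.Consistent ∧ υ.Alternating hP) ∧
    ∃ p : RAM.Program, EmbeddedGraph.FindsThreadedCircuitPartitionInLinearTime p :=
  ⟨fun _ _ _ _ _ hP hG => ⟨hG.existsUnique_threadedCircuitPartition,
    hG.exists_consistent_alternating hP⟩, _, EmbeddedGraph.finds_partitionProgram⟩
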